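/- Let $n\ge 1$ and $d\ge 2$ be integers and $\delta\in[0,\tfrac12]$. Let $S_0,S_1,\dots,S_n\in\{-1,1\}$ be the Markov chain with $S_0$ uniform and, for $1\le i\le n$, $S_i=S_{i-1}$ with probability $1-\delta$ and $S_i=-S_{i-1}$ with probability $\delta$. For $\theta_*\in\mathbb{R}^d$ one observes $X_i=S_i\theta_*+Z_i$, $1\le i\le n$, where $Z_1,\dots,Z_n$ are i.i.d. $N(0,I_d)$, independent of the chain. Let $\mathsf{loss}(\hat\theta,\theta_*)=\min\{\|\hat\theta-\theta_*\|,\|\hat\theta+\theta_*\|\}$ with the Euclidean norm and, for $t\ge 0$, let \[ \mathsf{M}(n,d,\delta,t)=\inf_{\hat\theta}\ \sup_{\|\theta_*\|=t}\ \mathbb{E}\big[\mathsf{loss}(\theta_*,\hat\theta(X_1,\dots,X_n))\big] \] be the local minimax rate, where the infimum is over all measurable estimators $\hat\theta:(\mathbb{R}^d)^n\to\mathbb{R}^d$ (which may depend on $n,d,\delta,t$). Theorem. There is a numerical constant $c>0$ such that for all $n,d,\delta,t$ as above with $2\le d\le\delta n$ and $n\ge\frac{128}{d}$, \[ \mathsf{M}(n,d,\delta,t)\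 \ge\ \frac{c}{\sqrt{\log n}}\cdot \begin{cases} t, & t\le\left(\frac{\delta d}{n}\right)^{1/4},\\ \frac1t\sqrt{\frac{\delta d}{n}}, & \left(\frac{\delta d}{n}\right)^{1/4}\le t\le\sqrt{\delta},\\ \sqrt{\frac dn}, & t\ge\sqrt{\delta}, \end{cases} \] where $\log$ is the natural logarithm. -/

import Mathlib

open MeasureTheory ProbabilityTheory
open scoped ENNReal

/-- Probability that the binary symmetric Markov chain `S₀, …, Sₙ` on `{-1, 1}` (here `ℤˣ`), with
`S₀` uniform and flip probability `δ`, follows the path `s`. -/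
noncomputable def signPathProb {n : ℕ} (δ : ℝ) (s : Fin (n + 1) → ℤˣ) : ℝ :=
  (1 / 2) * ∏ i : Fin n, if s i.succ = s i.castSucc then 1 - δ else δ

/-- The law of the sign chain `(S₀, …, Sₙ)`. -/
noncomputable def signChainLaw (n : ℕ) (δ : ℝ) : Measure (Fin (n + 1) → ℤˣ) :=
  ∑ s : Fin (n + 1) → ℤˣ, ENNReal.ofReal (signPathProb δ s) • Measure.dirac s

/-- The observations `Xᵢ = Sᵢ θ + Zᵢ`, `i = 1, …, n` (stored at the index `i - 1`), as a function
of the signs `(S₀, …, Sₙ)` and the noise vectors `(Z₁, …, Zₙ)`. -/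
noncomputable def observations {n d : ℕ} (θ : EuclideanSpace ℝ (Fin d))
    (ω : (Fin (n + 1) → ℤˣ) × (Fin n → EuclideanSpace ℝ (Fin d))) :
    Fin n → EuclideanSpace ℝ (Fin d) :=
  fun i => (((ω.1 i.succ : ℤˣ) : ℤ) : ℝ) • θ + ω.2 i

/-- The law of the sample `(X₁, …, Xₙ)` of the hidden Markov Gaussian model: the noise vectors are
i.i.d. standard Gaussian in `ℝᵈ` and independent of the sign chain. -/
noncomputable def sampleLaw (n d : ℕ) (δ : ℝ) (θ : EuclideanSpace ℝ (Fin d)) :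
    Measure (Fin n → EuclideanSpace ℝ (Fin d)) :=
  ((signChainLaw n δ).prod
    (Measure.pi fun _ : Fin n => stdGaussian (EuclideanSpace ℝ (Fin d)))).map (observations θ)

/-- Euclidean distance up to a global sign. -/
noncomputable def signLoss {d : ℕ} (θ' θ : EuclideanSpace ℝ (Fin d)) : ℝ :=
  min ‖θ' - θ‖ ‖θ' + θ‖

/-- The local minimax rate: the infimum over all estimators (measurable functions of the sample,
which may depend on `n, d, δ, t`) of the largest expected loss over the parameters of norm `t`. -/
noncomputable def localMinimaxRate (n d : ℕ) (δ t : ℝ) : ℝ≥0∞ :=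
  ⨅ (est : (Fin n → EuclideanSpace ℝ (Fin d)) → EuclideanSpace ℝ (Fin d))
    (_ : Measurable est),
  ⨆ (θ : EuclideanSpace ℝ (Fin d)) (_ : ‖θ‖ = t),
    ∫⁻ x, ENNReal.ofReal (signLoss θ (est x)) ∂(sampleLaw n d δ θ)

/-- The three-piece rate (the pieces agree at the two break points). -/
noncomputable def threePieceRate (n d : ℕ) (δ t : ℝ) : ℝ :=
  if t ≤ (δ * d / n) ^ (1 / 4 : ℝ) then t
  else if t ≤ √δ then 1 / t * √(δ * d / n)
  else √((d : ℝ) / n)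

/-! The bound is proved without the logarithmic factor, by Assouad's method on a cube of parameters
of norm `t`; since `log n ≥ 1` here, the stated form follows.

The main difficulty is that the sample law is a mixture over dependent signs. It is removed by a
refresh representation: flipping with probability `δ` is the same as redrawing the sign uniformly
with probability `2δ` and keeping it otherwise. Given the set `R` of refresh steps, the observations
split into blocks, each with its own independent uniform sign, so the likelihood is an explicit
product of hyperbolic cosines (`labelLaw_eq_withDensity`). Testing errors are linear in the law, so
a bound for each `R` can be averaged over `R` (`sampleLaw_real_eq_sum`); no divergence between the
full mixtures is needed.

For `‖θ‖ = ‖θ'‖ = t` and `D = t² - ⟪θ', θ⟫`, rotation invariance makes the noise enter in the same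
way under both parameters, and symmetric noise can only shrink the relevant increment of `log cosh`.
A block of length `l` then contributes at most `l D min(1, l t²)` to the divergence
(`labelLaw_testing_error`). The lengths add up to `n`, and the expected sum of their squares is at
most `n/δ` (`sum_refreshWeight_card_sq_le`), so two parameters are hard to distinguish when `D
min(n, t² n/δ)` is small. Neighbouring vertices of the cube have `D = 2b²`; the largest admissible
`b` gives the three regimes. -/

/-! ### Densities of shifted Gaussian vectors and rotation invariance. -/

section GaussianShift

theorem pi_withDensity {ι : Type*} [Fintype ι] {α : ι → Type*} [∀ i, MeasurableSpace (α i)]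
    (μ : ∀ i, Measure (α i)) [∀ i, IsProbabilityMeasure (μ i)] (g : ∀ i, α i → ℝ≥0∞)
    (hg : ∀ i, Measurable (g i)) [∀ i, SigmaFinite ((μ i).withDensity (g i))] :
    Measure.pi (fun i => (μ i).withDensity (g i))
      = (Measure.pi μ).withDensity (fun x => ∏ i, g i (x i)) := by
  refine Measure.pi_eq fun s hs => ?_
  rw [withDensity_apply _ (MeasurableSet.univ_pi hs), ← lintegral_indicator (.univ_pi hs)]
  have hind : (Set.univ.pi s).indicator (fun x : ∀ i, α i => ∏ i, g i (x i))
      = fun x => ∏ i, (s i).indicator (g i) (x i) := by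
    funext x
    by_cases hx : x ∈ Set.univ.pi s
    · rw [Set.indicator_of_mem hx]
      exact Finset.prod_congr rfl fun i _ =>
        (Set.indicator_of_mem (hx i (Set.mem_univ i)) _).symm
    · rw [Set.indicator_of_notMem hx]
      simp only [Set.mem_univ_pi, not_forall] at hx
      obtain ⟨i, hi⟩ := hx
      exact (Finset.prod_eq_zero (Finset.mem_univ i) (Set.indicator_of_notMem hi _)).symm
  have hm : ∀ i, Measurable ((s i).indicator (g i)) := fun i => (hg i).indicator (hs i)
  rw [hind, lintegral_prod_eq_prod_lintegral_of_indepFun Finset.univ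
    (fun i (x : ∀ i, α i) => (s i).indicator (g i) (x i))
    (iIndepFun_pi fun i => (hm i).aemeasurable) fun i => (hm i).comp (measurable_pi_apply i)]
  refine Finset.prod_congr rfl fun i _ => ?_
  rw [withDensity_apply _ (hs i), ← lintegral_indicator (hs i)]
  exact ((measurePreserving_eval μ i).lintegral_comp (hm i))

theorem pi_map_add_eq_withDensity {ι : Type*} [Fintype ι] {E : Type*} [AddGroup E]
    [MeasurableSpace E] [MeasurableAdd E] (μ : Measure E) [IsProbabilityMeasure μ]
    (u : ι → E) (g : ι → E → ℝ≥0∞) (hg : ∀ i, Measurable (g i))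
    (h : ∀ i, μ.map (fun z => u i + z) = μ.withDensity (g i)) :
    (Measure.pi fun _ : ι => μ).map (fun z i => u i + z i)
      = (Measure.pi fun _ : ι => μ).withDensity (fun x => ∏ i, g i (x i)) := by
  have hp : ∀ i, IsProbabilityMeasure (μ.map (fun z => u i + z)) := fun i =>
    Measure.isProbabilityMeasure_map (measurable_const_add (u i)).aemeasurable
  have hs : ∀ i, SigmaFinite (μ.withDensity (g i)) := fun i => by
    rw [← h i]; infer_instance
  rw [Measure.pi_map_pi (f := fun i z => u i + z)
    fun i => (measurable_const_add (u i)).aemeasurable, ← pi_withDensity _ g hg]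
  exact congrArg _ (funext h)

theorem gaussianReal_map_add_eq_withDensity (u : ℝ) :
    (gaussianReal 0 1).map (fun z => u + z)
      = (gaussianReal 0 1).withDensity (fun x => ENNReal.ofReal (Real.exp (u * x - u ^ 2 / 2))) := by
  rw [gaussianReal_map_const_add, gaussianReal_of_var_ne_zero _ one_ne_zero,
    gaussianReal_of_var_ne_zero _ one_ne_zero,
    ← withDensity_mul _ (measurable_gaussianPDF 0 1) (by fun_prop)]
  congr 1
  funext x
  simp only [Pi.mul_apply, gaussianPDF, gaussianPDFReal]
  rw [← ENNReal.ofReal_mul (by positivity), mul_assoc _ (Real.exp _) (Real.exp _), ← Real.exp_add]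
  congr 3
  push_cast
  ring

/-- The finite-dimensional Cameron–Martin formula, assembled from its one-dimensional case through
the product structure. -/
theorem stdGaussian_map_add_eq_withDensity {ι : Type*} [Fintype ι] (u : EuclideanSpace ℝ ι) :
    (stdGaussian (EuclideanSpace ℝ ι)).map (fun z => u + z)
      = (stdGaussian (EuclideanSpace ℝ ι)).withDensity
        (fun x => ENNReal.ofReal (Real.exp (inner ℝ u x - ‖u‖ ^ 2 / 2))) := by
  have hL : Measurable (WithLp.toLp 2 : (ι → ℝ) → EuclideanSpace ℝ ι) := by fun_prop
  rw [← map_pi_eq_stdGaussian, Measure.map_map (by fun_prop) hL]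
  have hcomp : ((fun z : EuclideanSpace ℝ ι => u + z) ∘ (WithLp.toLp 2 : (ι → ℝ) → _))
      = WithLp.toLp 2 ∘ (fun (z : ι → ℝ) i => u i + z i) := by
    funext z; ext i; simp
  rw [hcomp, ← Measure.map_map hL (by fun_prop),
    pi_map_add_eq_withDensity (gaussianReal 0 1) (fun i => u i) _ (fun i => by fun_prop)
      fun i => gaussianReal_map_add_eq_withDensity (u i)]
  ext s hs
  rw [Measure.map_apply hL hs, withDensity_apply _ (hL hs), withDensity_apply _ hs,
    setLIntegral_map hs (by fun_prop) hL]
  refine setLIntegral_congr_fun (hL hs) fun x _ => ?_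
  simp only
  rw [← ENNReal.ofReal_prod_of_nonneg fun i _ => (Real.exp_pos _).le, ← Real.exp_sum,
    Finset.sum_sub_distrib, ← Finset.sum_div, EuclideanSpace.real_norm_sq_eq, PiLp.inner_apply]
  simp [mul_comm]

theorem pi_stdGaussian_map_add_eq_withDensity {κ ι : Type*} [Fintype κ] [Fintype ι]
    (u : κ → EuclideanSpace ℝ ι) :
    (Measure.pi fun _ : κ => stdGaussian (EuclideanSpace ℝ ι)).map (fun z i => u i + z i)
      = (Measure.pi fun _ : κ => stdGaussian (EuclideanSpace ℝ ι)).withDensity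
        (fun x => ENNReal.ofReal (Real.exp (∑ i, (inner ℝ (u i) (x i) - ‖u i‖ ^ 2 / 2)))) := by
  rw [pi_map_add_eq_withDensity _ u _ (fun i => by fun_prop)
    fun i => stdGaussian_map_add_eq_withDensity (u i)]
  congr 1
  funext x
  rw [Real.exp_sum, ENNReal.ofReal_prod_of_nonneg fun i _ => (Real.exp_pos _).le]

theorem pi_stdGaussian_measurePreserving {κ E : Type*} [Fintype κ] [NormedAddCommGroup E]
    [InnerProductSpace ℝ E] [FiniteDimensional ℝ E] [MeasurableSpace E] [BorelSpace E]
    (e : E ≃ₗᵢ[ℝ] E) :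
    MeasurePreserving (fun (z : κ → E) i => e (z i))
      (Measure.pi fun _ : κ => stdGaussian E) (Measure.pi fun _ : κ => stdGaussian E) :=
  measurePreserving_pi _ _ fun _ => ⟨e.continuous.measurable, stdGaussian_map e⟩

end GaussianShift

/-! ### Increments of `log cosh`. -/

section LogCosh

theorem Real.sinh_le_self_mul_cosh {x : ℝ} (hx : 0 ≤ x) : Real.sinh x ≤ x * Real.cosh x := by
  have hd : ∀ y : ℝ, HasDerivAt (fun y => y * Real.cosh y - Real.sinh y) (y * Real.sinh y) y := by
    intro y
    have := ((hasDerivAt_id y).mul (Real.hasDerivAt_cosh y)).sub (Real.hasDerivAt_sinh y)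
    refine this.congr_deriv ?_
    simp
  have hmono : MonotoneOn (fun y : ℝ => y * Real.cosh y - Real.sinh y) (Set.Ici 0) := by
    refine monotoneOn_of_deriv_nonneg (convex_Ici 0)
      (fun y _ => (hd y).continuousAt.continuousWithinAt)
      (fun y _ => (hd y).differentiableAt.differentiableWithinAt) fun y hy => ?_
    rw [(hd y).deriv]
    rw [interior_Ici, Set.mem_Ioi] at hy
    exact mul_nonneg hy.le (Real.sinh_nonneg_iff.2 hy.le)
  have := hmono Set.self_mem_Ici hx hx
  simp only [zero_mul, Real.sinh_zero, sub_zero] at this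
  linarith

theorem log_cosh_sub_log_cosh_le_sub {a b : ℝ} (hba : b ≤ a) :
    Real.log (Real.cosh a) - Real.log (Real.cosh b) ≤ a - b := by
  have h : Real.cosh a ≤ Real.cosh b * Real.exp (a - b) := by
    have h1 : Real.cosh a = Real.cosh b * Real.cosh (a - b) + Real.sinh b * Real.sinh (a - b) := by
      rw [← Real.cosh_add]; ring_nf
    have h2 : Real.sinh b * Real.sinh (a - b) ≤ Real.cosh b * Real.sinh (a - b) :=
      mul_le_mul_of_nonneg_right (Real.sinh_lt_cosh b).le (Real.sinh_nonneg_iff.2 (by linarith))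
    rw [h1, ← Real.cosh_add_sinh]
    linarith
  have := Real.log_le_log (Real.cosh_pos a) h
  rw [Real.log_mul (Real.cosh_pos b).ne' (Real.exp_pos _).ne', Real.log_exp] at this
  linarith

/-- Morally `(log cosh)' = tanh x ≤ x`. The calculation yields the exponent `(a² - b²)/2`, which is
at most `a (a - b)`. -/
theorem log_cosh_sub_log_cosh_le_mul_sub {a b : ℝ} (hb : 0 ≤ b) (hba : b ≤ a) :
    Real.log (Real.cosh a) - Real.log (Real.cosh b) ≤ a * (a - b) := by
  have hD : 0 ≤ a - b := by linarith
  have h : Real.cosh a ≤ Real.cosh b * Real.exp (a * (a - b)) := by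
    have h1 : Real.cosh a = Real.cosh b * Real.cosh (a - b) + Real.sinh b * Real.sinh (a - b) := by
      rw [← Real.cosh_add]; ring_nf
    have h2 : Real.sinh b * Real.sinh (a - b)
        ≤ (b * Real.cosh b) * ((a - b) * Real.cosh (a - b)) :=
      mul_le_mul (Real.sinh_le_self_mul_cosh hb) (Real.sinh_le_self_mul_cosh hD)
        (Real.sinh_nonneg_iff.2 hD) (mul_nonneg hb (Real.cosh_pos b).le)
    calc Real.cosh a
        ≤ Real.cosh b * Real.cosh (a - b) + (b * Real.cosh b) * ((a - b) * Real.cosh (a - b)) := by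
          linarith
      _ = Real.cosh b * (Real.cosh (a - b) * (b * (a - b) + 1)) := by ring
      _ ≤ Real.cosh b * (Real.exp ((a - b) ^ 2 / 2) * Real.exp (b * (a - b))) := by
          refine mul_le_mul_of_nonneg_left ?_ (Real.cosh_pos b).le
          exact mul_le_mul (Real.cosh_le_exp_half_sq _) (Real.add_one_le_exp _)
            (by positivity) (Real.exp_pos _).le
      _ ≤ Real.cosh b * Real.exp (a * (a - b)) := by
          rw [← Real.exp_add]
          refine mul_le_mul_of_nonneg_left (Real.exp_le_exp.2 ?_) (Real.cosh_pos b).le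
          nlinarith
  have := Real.log_le_log (Real.cosh_pos a) h
  rw [Real.log_mul (Real.cosh_pos b).ne' (Real.exp_pos _).ne', Real.log_exp] at this
  linarith

theorem cosh_add_mul_cosh_sub (x y : ℝ) :
    Real.cosh (x + y) * Real.cosh (x - y) = Real.cosh x ^ 2 + Real.sinh y ^ 2 := by
  rw [Real.cosh_add, Real.cosh_sub]
  linear_combination (Real.sinh y ^ 2) * Real.cosh_sq x + (Real.cosh x ^ 2) * Real.cosh_sq y

/-- By `cosh_add_mul_cosh_sub`, the left side is the logarithm of `(cosh² a + s) / (cosh² b + s)`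
with `s = sinh² w ≥ 0`, and this ratio decreases in `s`. Hence symmetric noise can be discarded. -/
theorem log_cosh_symm_sub_le {a b : ℝ} (hb : 0 ≤ b) (hba : b ≤ a) (w : ℝ) :
    (Real.log (Real.cosh (a + w)) + Real.log (Real.cosh (a - w)))
      - (Real.log (Real.cosh (b + w)) + Real.log (Real.cosh (b - w)))
      ≤ 2 * (Real.log (Real.cosh a) - Real.log (Real.cosh b)) := by
  have hc := fun x => Real.cosh_pos x
  have hle : Real.cosh b ^ 2 ≤ Real.cosh a ^ 2 := by
    refine pow_le_pow_left₀ (hc b).le (Real.cosh_le_cosh.2 ?_) 2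
    rwa [abs_of_nonneg hb, abs_of_nonneg (hb.trans hba)]
  have key : (Real.cosh (a + w) * Real.cosh (a - w)) * Real.cosh b ^ 2
      ≤ (Real.cosh (b + w) * Real.cosh (b - w)) * Real.cosh a ^ 2 := by
    rw [cosh_add_mul_cosh_sub, cosh_add_mul_cosh_sub]
    nlinarith [sq_nonneg (Real.sinh w)]
  have := Real.log_le_log (by have := hc (a + w); have := hc (a - w); have := hc b; positivity) key
  rw [Real.log_mul (mul_pos (hc _) (hc _)).ne' (pow_pos (hc _) 2).ne',
    Real.log_mul (hc _).ne' (hc _).ne', Real.log_mul (mul_pos (hc _) (hc _)).ne'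
    (pow_pos (hc _) 2).ne', Real.log_mul (hc _).ne' (hc _).ne', Real.log_pow, Real.log_pow] at this
  push_cast at this
  linarith

theorem log_cosh_neg (x : ℝ) : Real.log (Real.cosh (-x)) = Real.log (Real.cosh x) := by
  rw [Real.cosh_neg]

theorem abs_log_cosh_le (x : ℝ) : |Real.log (Real.cosh x)| ≤ |x| := by
  rw [abs_of_nonneg (Real.log_nonneg (Real.one_le_cosh x)), ← Real.cosh_abs]
  simpa using log_cosh_sub_log_cosh_le_sub (abs_nonneg x)

theorem continuous_log_cosh : Continuous fun x : ℝ => Real.log (Real.cosh x) :=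
  Real.continuous_cosh.log fun x => (Real.cosh_pos x).ne'

end LogCosh

/-! ### Testing error from a divergence bound. -/

section Testing

/-- The inequality holds pointwise before integration: with `l = log (p/q)`, the function `3/2 p - q
- p l` is at most `p` on `A` and at most `q` off `A`, while `3/2 p - q` integrates to `1/2`. -/
theorem half_sub_integral_log_le_testing_error {X : Type*} [MeasurableSpace X] {γ : Measure X}
    {p q : X → ℝ} (hpm : Measurable p) (hqm : Measurable q) (hp : ∀ x, 0 < p x)
    (hq : ∀ x, 0 < q x)
    [IsProbabilityMeasure (γ.withDensity fun x => ENNReal.ofReal (p x))]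
    [IsProbabilityMeasure (γ.withDensity fun x => ENNReal.ofReal (q x))]
    (hint : Integrable (fun x => Real.log (p x) - Real.log (q x))
      (γ.withDensity fun x => ENNReal.ofReal (p x)))
    {A : Set X} (hA : MeasurableSet A) :
    1 / 2 - ∫ x, (Real.log (p x) - Real.log (q x)) ∂(γ.withDensity fun x => ENNReal.ofReal (p x))
      ≤ (γ.withDensity fun x => ENNReal.ofReal (p x)).real A
        + (γ.withDensity fun x => ENNReal.ofReal (q x)).real Aᶜ := by
  have hone : ∀ {r : X → ℝ}, Measurable r → (∀ x, 0 < r x) →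
      IsProbabilityMeasure (γ.withDensity fun x => ENNReal.ofReal (r x)) →
      Integrable r γ ∧ ∫ x, r x ∂γ = 1 ∧ ∀ {s : Set X}, MeasurableSet s →
        (γ.withDensity fun x => ENNReal.ofReal (r x)).real s = ∫ x, s.indicator r x ∂γ := by
    intro r hr hr0 hprob
    have h1 : ∫⁻ x, ENNReal.ofReal (r x) ∂γ = 1 := by
      rw [← setLIntegral_univ, ← withDensity_apply _ MeasurableSet.univ, measure_univ]
    have hi : Integrable r γ := by
      refine ⟨hr.aestronglyMeasurable, ?_⟩
      rw [hasFiniteIntegral_iff_ofReal (.of_forall fun x => (hr0 x).le), h1]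
      exact ENNReal.one_lt_top
    refine ⟨hi, ?_, fun {s} hs => ?_⟩
    · rw [integral_eq_lintegral_of_nonneg_ae (.of_forall fun x => (hr0 x).le)
        hr.aestronglyMeasurable, h1, ENNReal.toReal_one]
    · rw [Measure.real, withDensity_apply _ hs, integral_indicator hs,
        integral_eq_lintegral_of_nonneg_ae (.of_forall fun x => (hr0 x).le)
        hr.aestronglyMeasurable]
  obtain ⟨hpi, hp1, hpA⟩ := hone hpm hp inferInstance
  obtain ⟨hqi, hq1, hqA⟩ := hone hqm hq inferInstance
  rw [hpA hA, hqA hA.compl]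
  have hlt : ∀ᵐ x ∂γ, ENNReal.ofReal (p x) < ∞ := .of_forall fun x => ENNReal.ofReal_lt_top
  have hpm' : Measurable fun x => ENNReal.ofReal (p x) := hpm.ennreal_ofReal
  rw [integrable_withDensity_iff_integrable_smul' hpm' hlt] at hint
  rw [integral_withDensity_eq_integral_toReal_smul hpm' hlt]
  simp only [ENNReal.toReal_ofReal (hp _).le, smul_eq_mul] at hint ⊢
  rw [← integral_add (hpi.indicator hA) (hqi.indicator hA.compl)]
  have hpq : Integrable (fun x => 3 / 2 * p x - q x) γ := (hpi.const_mul _).sub hqi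
  have hlow : 1 / 2 - ∫ x, p x * (Real.log (p x) - Real.log (q x)) ∂γ
      = ∫ x, (3 / 2 * p x - q x - p x * (Real.log (p x) - Real.log (q x))) ∂γ := by
    rw [integral_sub hpq hint, integral_sub (hpi.const_mul _) hqi,
      integral_const_mul, hp1, hq1]
    norm_num
  rw [hlow]
  refine integral_mono (hpq.sub hint)
    ((hpi.indicator hA).add (hqi.indicator hA.compl)) fun x => ?_
  set l := Real.log (p x) - Real.log (q x) with hl
  have hqx : q x = p x * Real.exp (-l) := by
    rw [hl, neg_sub, Real.exp_sub, Real.exp_log (hp x), Real.exp_log (hq x),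
      mul_div_cancel₀ _ (hp x).ne']
  by_cases hx : x ∈ A
  · simp only [Set.indicator_of_mem hx, Set.indicator_of_notMem (show x ∉ Aᶜ from not_not.2 hx)]
    have := Real.add_one_le_exp (-l)
    rw [hqx]
    nlinarith [hp x]
  · simp only [Set.indicator_of_notMem hx, Set.indicator_of_mem (show x ∈ Aᶜ from hx)]
    -- The tangent bound for `exp` at `log 2 - l` suffices because `log 2 ≥ 1/2`.
    have h2 : 3 / 2 - l ≤ 2 * Real.exp (-l) := by
      have := Real.add_one_le_exp (Real.log 2 - l)
      rw [sub_eq_add_neg (Real.log 2), Real.exp_add, Real.exp_log two_pos] at this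
      linarith [Real.log_two_gt_d9]
    rw [hqx]
    nlinarith [hp x]

end Testing

/-! ### Blocks with independent signs: likelihood and divergence. -/

section LabelledModel

variable {κ L ι : Type*} [Fintype κ] [DecidableEq L] [Fintype ι]

/-- The law of `(V (τ i) • θ + Zᵢ)ᵢ` with independent standard Gaussian vectors `Zᵢ` and
independent uniform signs `V k`: observations with the same label `τ i` share their sign. -/
noncomputable def labelLaw [Fintype L] (τ : κ → L) (θ : EuclideanSpace ℝ ι) :
    Measure (κ → EuclideanSpace ℝ ι) :=
  ∑ V : L → ℤˣ, ((2 : ℝ≥0∞) ^ Fintype.card L)⁻¹ •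
    (Measure.pi fun _ : κ => stdGaussian (EuclideanSpace ℝ ι)).map
      fun z i => (((V (τ i) : ℤˣ) : ℤ) : ℝ) • θ + z i

theorem measurable_add_left_pi (u : κ → EuclideanSpace ℝ ι) :
    Measurable fun (z : κ → EuclideanSpace ℝ ι) i => u i + z i :=
  (continuous_pi fun i => continuous_const.add (continuous_apply i)).measurable

/-- The sum of the observations that carry the label `k`. -/
noncomputable def labelSum (τ : κ → L) (k : L) (x : κ → EuclideanSpace ℝ ι) :
    EuclideanSpace ℝ ι :=
  ∑ i with τ i = k, x i

/-- The density of `labelLaw τ θ` with respect to the law of the noise. -/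
noncomputable def labelDensity [Fintype L] (τ : κ → L) (θ : EuclideanSpace ℝ ι)
    (x : κ → EuclideanSpace ℝ ι) : ℝ :=
  Real.exp (-(Fintype.card κ * (‖θ‖ ^ 2 / 2))) * ∏ k, Real.cosh (inner ℝ θ (labelSum τ k x))

theorem labelDensity_pos [Fintype L] (τ : κ → L) (θ : EuclideanSpace ℝ ι) (x : κ → EuclideanSpace ℝ ι) :
    0 < labelDensity τ θ x :=
  mul_pos (Real.exp_pos _) (Finset.prod_pos fun _ _ => Real.cosh_pos _)

theorem continuous_labelSum (τ : κ → L) (k : L) :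
    Continuous (labelSum τ k : (κ → EuclideanSpace ℝ ι) → _) :=
  continuous_finsetSum _ fun i _ => continuous_apply i

theorem measurable_labelDensity [Fintype L] (τ : κ → L) (θ : EuclideanSpace ℝ ι) :
    Measurable (labelDensity τ θ) := by
  refine Continuous.measurable (continuous_const.mul (continuous_finsetProd _ fun k _ => ?_))
  exact Real.continuous_cosh.comp (continuous_const.inner (continuous_labelSum τ k))

theorem log_labelDensity [Fintype L] (τ : κ → L) (θ : EuclideanSpace ℝ ι) (x : κ → EuclideanSpace ℝ ι) :
    Real.log (labelDensity τ θ x)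
      = -(Fintype.card κ * (‖θ‖ ^ 2 / 2))
        + ∑ k, Real.log (Real.cosh (inner ℝ θ (labelSum τ k x))) := by
  rw [labelDensity, Real.log_mul (Real.exp_pos _).ne'
    (Finset.prod_pos fun _ _ => Real.cosh_pos _).ne', Real.log_exp,
    Real.log_prod fun k _ => (Real.cosh_pos _).ne']

/-- Grouping the exponent by label factorises the sum over signs; each label contributes `exp S +
exp (-S)`. -/
theorem sum_exp_labels [Fintype L] (τ : κ → L) (w : κ → ℝ) :
    ∑ V : L → ℤˣ, Real.exp (∑ i, (((V (τ i) : ℤˣ) : ℤ) : ℝ) * w i)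
      = 2 ^ Fintype.card L * ∏ k, Real.cosh (∑ i with τ i = k, w i) := by
  have h1 : ∀ V : L → ℤˣ, Real.exp (∑ i, (((V (τ i) : ℤˣ) : ℤ) : ℝ) * w i)
      = ∏ k, Real.exp ((((V k : ℤˣ) : ℤ) : ℝ) * ∑ i with τ i = k, w i) := by
    intro V
    rw [← Real.exp_sum, ← Finset.sum_fiberwise Finset.univ τ]
    congr 1
    refine Finset.sum_congr rfl fun k _ => ?_
    rw [Finset.mul_sum]
    refine Finset.sum_congr rfl fun i hi => ?_
    rw [(Finset.mem_filter.1 hi).2]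
  rw [Finset.sum_congr rfl fun V _ => h1 V, ← Fintype.piFinset_univ,
    ← Finset.prod_univ_sum (fun _ => Finset.univ)
      (fun k (v : ℤˣ) => Real.exp (((v : ℤ) : ℝ) * ∑ i with τ i = k, w i)),
    ← Finset.card_univ, ← Finset.prod_const, ← Finset.prod_mul_distrib]
  refine Finset.prod_congr rfl fun k _ => ?_
  rw [show (Finset.univ : Finset ℤˣ) = {1, -1} from rfl, Finset.sum_pair (by decide), Real.cosh_eq]
  simp
  ring

theorem labelLaw_eq_withDensity [Fintype L] (τ : κ → L) (θ : EuclideanSpace ℝ ι) :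
    labelLaw τ θ = (Measure.pi fun _ : κ => stdGaussian (EuclideanSpace ℝ ι)).withDensity
      fun x => ENNReal.ofReal (labelDensity τ θ x) := by
  have hsgn : ∀ v : ℤˣ, ‖((v : ℤ) : ℝ) • θ‖ = ‖θ‖ := fun v => by
    rcases Int.units_eq_one_or v with rfl | rfl <;> simp
  ext s hs
  rw [labelLaw, Measure.finsetSum_apply, withDensity_apply _ hs]
  simp only [Measure.smul_apply, pi_stdGaussian_map_add_eq_withDensity, withDensity_apply _ hs,
    smul_eq_mul, hsgn]
  rw [← Finset.mul_sum, ← lintegral_finsetSum _ fun V _ => by fun_prop,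
    ← lintegral_const_mul _ (by fun_prop)]
  refine lintegral_congr fun x => ?_
  rw [← ENNReal.ofReal_sum_of_nonneg fun V _ => (Real.exp_pos _).le]
  have h2 : ((2 : ℝ≥0∞) ^ Fintype.card L)⁻¹ = ENNReal.ofReal (((2 : ℝ) ^ Fintype.card L)⁻¹) := by
    rw [ENNReal.ofReal_inv_of_pos (by positivity), ENNReal.ofReal_pow two_pos.le]
    simp
  rw [h2, ← ENNReal.ofReal_mul (by positivity)]
  congr 1
  simp only [Finset.sum_sub_distrib, real_inner_smul_left, Finset.sum_const, Finset.card_univ,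
    nsmul_eq_mul]
  simp only [sub_eq_neg_add, Real.exp_add]
  rw [← Finset.mul_sum, sum_exp_labels, labelDensity]
  simp only [labelSum, inner_sum]
  field_simp

instance isProbabilityMeasure_labelLaw [Fintype L] (τ : κ → L) (θ : EuclideanSpace ℝ ι) :
    IsProbabilityMeasure (labelLaw τ θ) := by
  refine ⟨?_⟩
  have h : ∀ V : L → ℤˣ, IsProbabilityMeasure
      ((Measure.pi fun _ : κ => stdGaussian (EuclideanSpace ℝ ι)).map
        fun z i => (((V (τ i) : ℤˣ) : ℤ) : ℝ) • θ + z i) := fun V =>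
    Measure.isProbabilityMeasure_map (measurable_add_left_pi _).aemeasurable
  rw [labelLaw, Measure.finsetSum_apply]
  simp only [Measure.smul_apply, measure_univ, smul_eq_mul, mul_one, Finset.sum_const,
    Finset.card_univ, Fintype.card_fun, Fintype.card_units_int, nsmul_eq_mul]
  push_cast
  exact ENNReal.mul_inv_cancel (by simp) (by simp)

theorem integrable_log_cosh_inner_labelSum (τ : κ → L) (k : L) (θ : EuclideanSpace ℝ ι) (a : ℝ) :
    Integrable (fun z => Real.log (Real.cosh (a + inner ℝ θ (labelSum τ k z))))
      (Measure.pi fun _ : κ => stdGaussian (EuclideanSpace ℝ ι)) := by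
  have hlin : Integrable (fun z : κ → EuclideanSpace ℝ ι => a + inner ℝ θ (labelSum τ k z))
      (Measure.pi fun _ : κ => stdGaussian (EuclideanSpace ℝ ι)) := by
    refine (integrable_const a).add ?_
    simp only [labelSum, inner_sum]
    refine integrable_finsetSum _ fun i _ => ?_
    have hi : Integrable (fun x : EuclideanSpace ℝ ι => (inner ℝ θ x : ℝ))
        (stdGaussian (EuclideanSpace ℝ ι)) := IsGaussian.integrable_id.const_inner θ
    exact integrable_comp_eval (μ := fun _ : κ => stdGaussian (EuclideanSpace ℝ ι)) (i := i) hi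
  refine hlin.mono ?_ (.of_forall fun z => by
    simpa only [Real.norm_eq_abs] using abs_log_cosh_le _)
  exact (continuous_log_cosh.comp (continuous_const.add
    (continuous_const.inner (continuous_labelSum τ k)))).aestronglyMeasurable

/-- The mean of `log cosh (a + ⟪θ, W⟫)`, where `W` is the sum of the noise vectors labelled `k`. -/
noncomputable def meanLogCosh (τ : κ → L) (k : L) (θ : EuclideanSpace ℝ ι) (a : ℝ) : ℝ :=
  ∫ z, Real.log (Real.cosh (a + inner ℝ θ (labelSum τ k z)))
    ∂(Measure.pi fun _ : κ => stdGaussian (EuclideanSpace ℝ ι))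

theorem meanLogCosh_map (τ : κ → L) (k : L) (θ : EuclideanSpace ℝ ι) (a : ℝ)
    (e : EuclideanSpace ℝ ι ≃ₗᵢ[ℝ] EuclideanSpace ℝ ι) :
    meanLogCosh τ k (e θ) a = meanLogCosh τ k θ a := by
  have he := pi_stdGaussian_measurePreserving (κ := κ) e
  have hc : Continuous fun z : κ → EuclideanSpace ℝ ι =>
      Real.log (Real.cosh (a + inner ℝ (e θ) (labelSum τ k z))) :=
    continuous_log_cosh.comp (continuous_const.add
      (continuous_const.inner (continuous_labelSum τ k)))
  rw [meanLogCosh, ← he.map_eq, integral_map he.measurable.aemeasurable hc.aestronglyMeasurable]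
  refine integral_congr_ae (.of_forall fun z => ?_)
  have : labelSum τ k (fun i => e (z i)) = e (labelSum τ k z) := by simp [labelSum]
  simp only [this, LinearIsometryEquiv.inner_map_map]

/-- A reflection exchanges two vectors of equal norm and preserves the noise law. The expected
log-likelihoods under `θ` and `θ'` thus differ only through the shift `a`. -/
theorem meanLogCosh_eq_of_norm_eq (τ : κ → L) (k : L) {θ θ' : EuclideanSpace ℝ ι}
    (h : ‖θ‖ = ‖θ'‖) (a : ℝ) : meanLogCosh τ k θ' a = meanLogCosh τ k θ a := by
  rw [← Submodule.reflection_sub h]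
  exact meanLogCosh_map τ k θ a _

theorem meanLogCosh_sub (τ : κ → L) (k : L) (θ : EuclideanSpace ℝ ι) (a : ℝ) :
    meanLogCosh τ k θ a = ∫ z, Real.log (Real.cosh (a - inner ℝ θ (labelSum τ k z)))
      ∂(Measure.pi fun _ : κ => stdGaussian (EuclideanSpace ℝ ι)) := by
  rw [← meanLogCosh_eq_of_norm_eq τ k (norm_neg θ).symm a, meanLogCosh]
  simp only [inner_neg_left, sub_eq_add_neg]

theorem meanLogCosh_unit_mul (τ : κ → L) (k : L) (θ : EuclideanSpace ℝ ι) (v : ℤˣ) (a : ℝ) :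
    meanLogCosh τ k θ (((v : ℤ) : ℝ) * a) = meanLogCosh τ k θ a := by
  rcases Int.units_eq_one_or v with rfl | rfl
  · simp
  · rw [meanLogCosh_sub, meanLogCosh]
    refine integral_congr_ae (.of_forall fun z => ?_)
    simp only
    rw [← log_cosh_neg]
    simp [sub_eq_add_neg, add_comm]

/-- The noise is symmetric, so twice the mean is the mean of the symmetrised integrand, to which
`log_cosh_symm_sub_le` applies pointwise. -/
theorem meanLogCosh_sub_le (τ : κ → L) (k : L) (θ : EuclideanSpace ℝ ι) {a b : ℝ} (hb : 0 ≤ b)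
    (hba : b ≤ a) :
    meanLogCosh τ k θ a - meanLogCosh τ k θ b
      ≤ Real.log (Real.cosh a) - Real.log (Real.cosh b) := by
  have hp := integrable_log_cosh_inner_labelSum τ k θ
  have hm : ∀ c : ℝ, Integrable
      (fun z => Real.log (Real.cosh (c - inner ℝ θ (labelSum τ k z))))
      (Measure.pi fun _ : κ => stdGaussian (EuclideanSpace ℝ ι)) := fun c => by
    simpa only [inner_neg_left, sub_eq_add_neg] using
      integrable_log_cosh_inner_labelSum τ k (-θ) c
  have hpm : ∀ c : ℝ, Integrable
      (fun z => Real.log (Real.cosh (c + inner ℝ θ (labelSum τ k z)))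
        + Real.log (Real.cosh (c - inner ℝ θ (labelSum τ k z))))
      (Measure.pi fun _ : κ => stdGaussian (EuclideanSpace ℝ ι)) := fun c => (hp c).add (hm c)
  have hsum : ∀ c : ℝ, 2 * meanLogCosh τ k θ c
      = ∫ z, (Real.log (Real.cosh (c + inner ℝ θ (labelSum τ k z)))
        + Real.log (Real.cosh (c - inner ℝ θ (labelSum τ k z))))
        ∂(Measure.pi fun _ : κ => stdGaussian (EuclideanSpace ℝ ι)) := fun c => by
    rw [integral_add (hp c) (hm c), ← meanLogCosh_sub, two_mul]
    rfl
  have hle : 2 * meanLogCosh τ k θ a - 2 * meanLogCosh τ k θ b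
      ≤ 2 * (Real.log (Real.cosh a) - Real.log (Real.cosh b)) := by
    rw [hsum, hsum, ← integral_sub (hpm a) (hpm b)]
    refine (integral_mono ((hpm a).sub (hpm b)) (integrable_const _)
      fun z => log_cosh_symm_sub_le hb hba (inner ℝ θ (labelSum τ k z))).trans ?_
    simp
  linarith

theorem inner_labelSum_shift (τ : κ → L) (k : L) (V : L → ℤˣ) (θ θ' : EuclideanSpace ℝ ι)
    (z : κ → EuclideanSpace ℝ ι) :
    inner ℝ θ' (labelSum τ k fun i => (((V (τ i) : ℤˣ) : ℤ) : ℝ) • θ + z i)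
      = (((V k : ℤˣ) : ℤ) : ℝ) * ((Finset.univ.filter fun i => τ i = k).card * inner ℝ θ' θ)
        + inner ℝ θ' (labelSum τ k z) := by
  have : (labelSum τ k fun i => (((V (τ i) : ℤˣ) : ℤ) : ℝ) • θ + z i)
      = (∑ i with τ i = k, (((V k : ℤˣ) : ℤ) : ℝ) • θ) + labelSum τ k z := by
    rw [labelSum, Finset.sum_add_distrib, labelSum]
    congr 1
    refine Finset.sum_congr rfl fun i hi => ?_
    rw [(Finset.mem_filter.1 hi).2]
  rw [this, inner_add_right, Finset.sum_const, ← Nat.cast_smul_eq_nsmul ℝ, real_inner_smul_right,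
    real_inner_smul_right]
  ring

theorem labelLaw_integrable_and_integral [Fintype L] {τ : κ → L} {θ : EuclideanSpace ℝ ι}
    {f : (κ → EuclideanSpace ℝ ι) → ℝ} (hf : Continuous f)
    (hint : ∀ V : L → ℤˣ, Integrable (fun z => f fun i => (((V (τ i) : ℤˣ) : ℤ) : ℝ) • θ + z i)
      (Measure.pi fun _ : κ => stdGaussian (EuclideanSpace ℝ ι))) {c : ℝ}
    (hc : ∀ V : L → ℤˣ, ∫ z, f (fun i => (((V (τ i) : ℤˣ) : ℤ) : ℝ) • θ + z i)
      ∂(Measure.pi fun _ : κ => stdGaussian (EuclideanSpace ℝ ι)) ≤ c) :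
    Integrable f (labelLaw τ θ) ∧ ∫ x, f x ∂(labelLaw τ θ) ≤ c := by
  have hm : ∀ V : L → ℤˣ, Integrable f (((2 : ℝ≥0∞) ^ Fintype.card L)⁻¹ •
      (Measure.pi fun _ : κ => stdGaussian (EuclideanSpace ℝ ι)).map
        fun z i => (((V (τ i) : ℤˣ) : ℤ) : ℝ) • θ + z i) := fun V => by
    refine Integrable.smul_measure ?_ (by simp)
    exact (integrable_map_measure hf.aestronglyMeasurable
      (measurable_add_left_pi _).aemeasurable).2 (hint V)
  refine ⟨integrable_finsetSum_measure.2 fun V _ => hm V, ?_⟩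
  rw [labelLaw, integral_finsetSum_measure fun V _ => hm V]
  have hV : ∀ V ∈ (Finset.univ : Finset (L → ℤˣ)), ∫ x, f x ∂(((2 : ℝ≥0∞) ^ Fintype.card L)⁻¹ •
      (Measure.pi fun _ : κ => stdGaussian (EuclideanSpace ℝ ι)).map
        fun z i => (((V (τ i) : ℤˣ) : ℤ) : ℝ) • θ + z i)
      ≤ ((2 : ℝ) ^ Fintype.card L)⁻¹ * c := fun V _ => by
    rw [integral_smul_measure, integral_map (measurable_add_left_pi _).aemeasurable hf.aestronglyMeasurable, smul_eq_mul]
    simp only [ENNReal.toReal_inv, ENNReal.toReal_pow, ENNReal.toReal_ofNat]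
    exact mul_le_mul_of_nonneg_left (hc V) (by positivity)
  refine (Finset.sum_le_sum hV).trans (le_of_eq ?_)
  rw [Finset.sum_const, Finset.card_univ, Fintype.card_fun, Fintype.card_units_int, nsmul_eq_mul]
  push_cast
  field_simp

/-- Two parameters of equal norm cannot be told apart with small error unless the bound on the
Kullback-Leibler divergence of their labelled models is large. -/
theorem labelLaw_testing_error [Fintype L] (τ : κ → L) {θ θ' : EuclideanSpace ℝ ι} (hn : ‖θ‖ = ‖θ'‖)
    (hin : 0 ≤ inner ℝ θ' θ) {A : Set (κ → EuclideanSpace ℝ ι)} (hA : MeasurableSet A) :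
    1 / 2 - ∑ k, (Finset.univ.filter fun i => τ i = k).card * (‖θ‖ ^ 2 - inner ℝ θ' θ)
        * min 1 ((Finset.univ.filter fun i => τ i = k).card * ‖θ‖ ^ 2)
      ≤ (labelLaw τ θ).real A + (labelLaw τ θ').real Aᶜ := by
  have hp1 : IsProbabilityMeasure ((Measure.pi fun _ : κ => stdGaussian (EuclideanSpace ℝ ι)).withDensity
      fun x => ENNReal.ofReal (labelDensity τ θ x)) := by
    rw [← labelLaw_eq_withDensity]; infer_instance
  have hp2 : IsProbabilityMeasure ((Measure.pi fun _ : κ => stdGaussian (EuclideanSpace ℝ ι)).withDensity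
      fun x => ENNReal.ofReal (labelDensity τ θ' x)) := by
    rw [← labelLaw_eq_withDensity]; infer_instance
  have hll : ∀ x, Real.log (labelDensity τ θ x) - Real.log (labelDensity τ θ' x)
      = ∑ k, (Real.log (Real.cosh (inner ℝ θ (labelSum τ k x)))
        - Real.log (Real.cosh (inner ℝ θ' (labelSum τ k x)))) := fun x => by
    rw [log_labelDensity, log_labelDensity, hn, Finset.sum_sub_distrib]
    ring
  have hle : inner ℝ θ' θ ≤ ‖θ‖ ^ 2 := by
    have := real_inner_le_norm θ' θ
    rwa [← hn, ← sq] at this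
  have hterm : ∀ (V : L → ℤˣ) (k : L), Integrable (fun z : κ → EuclideanSpace ℝ ι =>
      Real.log (Real.cosh (inner ℝ θ
        (labelSum τ k fun i => (((V (τ i) : ℤˣ) : ℤ) : ℝ) • θ + z i)))
      - Real.log (Real.cosh (inner ℝ θ'
        (labelSum τ k fun i => (((V (τ i) : ℤˣ) : ℤ) : ℝ) • θ + z i))))
      (Measure.pi fun _ : κ => stdGaussian (EuclideanSpace ℝ ι)) := fun V k => by
    simp only [inner_labelSum_shift]
    exact (integrable_log_cosh_inner_labelSum τ k θ _).sub
      (integrable_log_cosh_inner_labelSum τ k θ' _)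
  have hcont : Continuous fun x : κ → EuclideanSpace ℝ ι =>
      ∑ k, (Real.log (Real.cosh (inner ℝ θ (labelSum τ k x)))
        - Real.log (Real.cosh (inner ℝ θ' (labelSum τ k x)))) :=
    continuous_finsetSum _ fun k _ =>
      (continuous_log_cosh.comp (continuous_const.inner (continuous_labelSum τ k))).sub
        (continuous_log_cosh.comp (continuous_const.inner (continuous_labelSum τ k)))
  obtain ⟨hint, hval⟩ := labelLaw_integrable_and_integral (τ := τ) (θ := θ) hcont
    (fun V => integrable_finsetSum _ fun k _ => hterm V k)
    (c := ∑ k, (Finset.univ.filter fun i => τ i = k).card * (‖θ‖ ^ 2 - inner ℝ θ' θ)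
        * min 1 ((Finset.univ.filter fun i => τ i = k).card * ‖θ‖ ^ 2)) fun V => by
      rw [integral_finsetSum _ fun k _ => hterm V k]
      refine Finset.sum_le_sum fun k _ => ?_
      simp only [inner_labelSum_shift]
      rw [integral_sub (integrable_log_cosh_inner_labelSum τ k θ _)
        (integrable_log_cosh_inner_labelSum τ k θ' _)]
      change meanLogCosh τ k θ _ - meanLogCosh τ k θ' _ ≤ _
      -- Both means are now taken along the same vector and the block's sign drops out; the shifts
      -- left are `l ‖θ‖²` and `l ⟪θ', θ⟫`.
      rw [meanLogCosh_eq_of_norm_eq τ k hn, meanLogCosh_unit_mul, meanLogCosh_unit_mul,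
        real_inner_self_eq_norm_sq]
      set l : ℝ := ((Finset.univ.filter fun i => τ i = k).card : ℝ) with hl
      have hl0 : 0 ≤ l := Nat.cast_nonneg _
      have hb : 0 ≤ l * inner ℝ θ' θ := mul_nonneg hl0 hin
      have hba : l * inner ℝ θ' θ ≤ l * ‖θ‖ ^ 2 := mul_le_mul_of_nonneg_left hle hl0
      refine (meanLogCosh_sub_le τ k θ hb hba).trans ?_
      rw [mul_min_of_nonneg _ _ (mul_nonneg hl0 (sub_nonneg.2 hle))]
      -- The Lipschitz bound serves strong signal, the quadratic one weak signal.
      refine le_min ((log_cosh_sub_log_cosh_le_sub hba).trans (by linarith)) ?_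
      exact (log_cosh_sub_log_cosh_le_mul_sub hb hba).trans (by linarith)
  simp only [← hll] at hint hval
  rw [labelLaw_eq_withDensity] at hint hval
  have := half_sub_integral_log_le_testing_error (measurable_labelDensity τ θ)
    (measurable_labelDensity τ θ') (labelDensity_pos τ θ) (labelDensity_pos τ θ') hint hA
  rw [labelLaw_eq_withDensity, labelLaw_eq_withDensity]
  linarith

end LabelledModel

/-! ### Refresh representation of the sign chain and block lengths. -/

section Refresh

variable {n : ℕ}

/-- The last time up to `k` at which the chain is refreshed, if the steps in `R` refresh the sign;
time `0` counts as a refresh. -/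
def refreshLabel (R : Finset (Fin n)) : Fin (n + 1) → Fin (n + 1) :=
  Fin.induction 0 fun i prev => if i ∈ R then i.succ else prev

@[simp]
theorem refreshLabel_zero (R : Finset (Fin n)) : refreshLabel R 0 = 0 := rfl

theorem refreshLabel_succ (R : Finset (Fin n)) (i : Fin n) :
    refreshLabel R i.succ = if i ∈ R then i.succ else refreshLabel R i.castSucc := rfl

/-- The probability that exactly the steps in `R` refresh the sign, when each step does so with
probability `2δ`. -/
noncomputable def refreshWeight (δ : ℝ) (R : Finset (Fin n)) : ℝ :=
  (∏ _i ∈ R, 2 * δ) * ∏ _i ∈ Rᶜ, (1 - 2 * δ)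

theorem refreshWeight_nonneg {δ : ℝ} (h0 : 0 ≤ δ) (h1 : δ ≤ 1 / 2) (R : Finset (Fin n)) :
    0 ≤ refreshWeight δ R :=
  mul_nonneg (Finset.prod_nonneg fun _ _ => by linarith)
    (Finset.prod_nonneg fun _ _ => by linarith)

theorem sum_refreshWeight (δ : ℝ) : ∑ R : Finset (Fin n), refreshWeight δ R = 1 := by
  have := Fintype.prod_add (fun _ : Fin n => 2 * δ) fun _ => 1 - 2 * δ
  simp only [refreshWeight, ← this]
  simp

theorem comp_refreshLabel_eq_iff (R : Finset (Fin n)) (V s : Fin (n + 1) → ℤˣ) :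
    V ∘ refreshLabel R = s ↔
      (V 0 = s 0 ∧ ∀ i ∈ R, V i.succ = s i.succ) ∧ ∀ i ∈ Rᶜ, s i.succ = s i.castSucc := by
  constructor
  · rintro rfl
    refine ⟨⟨rfl, fun i hi => ?_⟩, fun i hi => ?_⟩
    · simp [refreshLabel_succ, hi]
    · simp [refreshLabel_succ, Finset.mem_compl.1 hi]
  · rintro ⟨⟨h0, hR⟩, hC⟩
    funext k
    induction k using Fin.induction with
    | zero => simpa using h0
    | succ i ih =>
      by_cases hi : i ∈ R
      · simpa [refreshLabel_succ, hi] using hR i hi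
      · rw [hC i (Finset.mem_compl.2 hi), ← ih]
        simp [refreshLabel_succ, hi]

/-- The path `s` must be constant across non-refresh steps. Then `V` is fixed at time `0` and at the
refresh times, and free at the `Rᶜ.card` others, which are never read. -/
theorem card_comp_refreshLabel_eq (R : Finset (Fin n)) (s : Fin (n + 1) → ℤˣ) :
    ((2 : ℝ) ^ (n + 1))⁻¹ * ∑ V : Fin (n + 1) → ℤˣ, (if V ∘ refreshLabel R = s then 1 else 0)
      = 1 / 2 * ((∏ _i ∈ R, 1 / 2) *
        ∏ i ∈ Rᶜ, if s i.succ = s i.castSucc then (1 : ℝ) else 0) := by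
  let B : Fin (n + 1) → Finset ℤˣ :=
    Fin.cases {s 0} fun i => if i ∈ R then {s i.succ} else Finset.univ
  have hB : ∀ V : Fin (n + 1) → ℤˣ,
      (V 0 = s 0 ∧ ∀ i ∈ R, V i.succ = s i.succ) ↔ V ∈ Fintype.piFinset B := by
    intro V
    rw [Fintype.mem_piFinset, Fin.forall_fin_succ]
    refine and_congr (by simp [B]) (forall_congr' fun i => ?_)
    by_cases hi : i ∈ R
    · simp [B, hi]
    · simp [B, hi, Int.units_eq_one_or]
  have hcard : ((Fintype.piFinset B).card : ℝ) = 2 ^ Rᶜ.card := by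
    rw [Fintype.card_piFinset, Fin.prod_univ_succ]
    push_cast
    have h1 : ∀ i : Fin n, ((B i.succ).card : ℝ) = if i ∈ R then 1 else 2 := by
      intro i
      by_cases hi : i ∈ R <;> simp [B, hi]
    have h0 : ((B 0).card : ℝ) = 1 := by simp [B]
    rw [h0, one_mul, Finset.prod_congr rfl fun i _ => h1 i, Finset.prod_ite]
    simp [Finset.filter_not, Finset.compl_eq_univ_sdiff]
  simp only [comp_refreshLabel_eq_iff]
  rw [Finset.prod_boole]
  by_cases hC : ∀ i ∈ Rᶜ, s i.succ = s i.castSucc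
  · have hsum : ∑ V : Fin (n + 1) → ℤˣ, (if (V 0 = s 0 ∧ ∀ i ∈ R, V i.succ = s i.succ) ∧
        ∀ i ∈ Rᶜ, s i.succ = s i.castSucc then (1 : ℝ) else 0) = 2 ^ Rᶜ.card := by
      rw [Finset.sum_congr rfl fun V _ => if_congr ((and_iff_left hC).trans (hB V)) rfl rfl,
        Finset.sum_boole, Finset.filter_mem_eq_inter, Finset.univ_inter, hcard]
    rw [hsum, if_pos hC, Finset.prod_const]
    have hn : n = R.card + Rᶜ.card := by simp [Finset.card_add_card_compl]
    have hpow : (2 : ℝ) ^ (n + 1) = 2 * 2 ^ R.card * 2 ^ Rᶜ.card := by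
      conv_lhs => rw [hn]
      ring
    rw [hpow, one_div, inv_pow]
    field_simp
  · rw [Finset.sum_congr rfl fun V _ => if_neg fun h => hC h.2, if_neg hC]
    simp

/-- Each transition probability equals `δ + (1 - 2δ) 1[no flip]`; expanding the product chooses a
refresh set, with `δ = 2δ · 1/2` separating the refresh from the uniform redraw. -/
theorem signPathProb_eq_sum_refresh (δ : ℝ) (s : Fin (n + 1) → ℤˣ) :
    signPathProb δ s = ∑ R : Finset (Fin n), refreshWeight δ R *
      (((2 : ℝ) ^ (n + 1))⁻¹ *
        ∑ V : Fin (n + 1) → ℤˣ, (if V ∘ refreshLabel R = s then 1 else 0)) := by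
  have h := Fintype.prod_add (fun _ : Fin n => δ)
    fun i => (1 - 2 * δ) * if s i.succ = s i.castSucc then 1 else 0
  have hl : signPathProb δ s = 1 / 2 * ∏ i : Fin n,
      (δ + (1 - 2 * δ) * if s i.succ = s i.castSucc then 1 else 0) := by
    rw [signPathProb]
    congr 1
    refine Finset.prod_congr rfl fun i _ => ?_
    split_ifs <;> ring
  rw [hl, h, Finset.mul_sum]
  refine Finset.sum_congr rfl fun R _ => ?_
  rw [card_comp_refreshLabel_eq, refreshWeight, Finset.prod_mul_distrib]
  have : ∏ _i ∈ R, δ = (∏ _i ∈ R, 2 * δ) * ∏ _i ∈ R, (1 / 2 : ℝ) := by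
    rw [← Finset.prod_mul_distrib]
    exact Finset.prod_congr rfl fun _ _ => by ring
  rw [this]
  ring

theorem refreshLabel_le (R : Finset (Fin n)) (k : Fin (n + 1)) : refreshLabel R k ≤ k := by
  induction k using Fin.induction with
  | zero => simp
  | succ i ih =>
    rw [refreshLabel_succ]
    split_ifs
    · exact le_rfl
    · exact ih.trans (Fin.castSucc_lt_succ).le

theorem succ_le_refreshLabel {R : Finset (Fin n)} {m : Fin n} (hm : m ∈ R) (k : Fin (n + 1))
    (hk : m.castSucc < k) : m.succ ≤ refreshLabel R k := by
  induction k using Fin.induction with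
  | zero => exact absurd hk (Fin.not_lt_zero _)
  | succ i ih =>
    rw [refreshLabel_succ]
    split_ifs with hi
    · exact Fin.succ_le_succ_iff.2 (Fin.castSucc_lt_succ_iff.1 hk)
    · refine ih (lt_of_le_of_ne (Fin.castSucc_le_castSucc_iff.2 (Fin.castSucc_lt_succ_iff.1 hk)) ?_)
      intro h
      exact hi (Fin.castSucc_injective n h ▸ hm)

theorem disjoint_of_refreshLabel_eq {R : Finset (Fin n)} {i j : Fin n}
    (h : refreshLabel R i.succ = refreshLabel R j.succ) : Disjoint R (Finset.Ioc i j) := by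
  rw [Finset.disjoint_left]
  intro m hm hmij
  rw [Finset.mem_Ioc] at hmij
  have h1 := succ_le_refreshLabel hm j.succ (Fin.castSucc_lt_succ_iff.2 hmij.2)
  have h2 := refreshLabel_le R i.succ
  rw [← h] at h1
  exact absurd hmij.1 (not_lt.2 (Fin.succ_le_succ_iff.1 (h1.trans h2)))

theorem sum_refreshWeight_disjoint (δ : ℝ) (T : Finset (Fin n)) :
    ∑ R : Finset (Fin n), refreshWeight δ R * (if Disjoint R T then 1 else 0)
      = (1 - 2 * δ) ^ T.card := by
  have h := Fintype.prod_add (fun m : Fin n => 2 * δ * if m ∉ T then 1 else 0)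
    fun _ => 1 - 2 * δ
  have hl : ∏ m : Fin n, (2 * δ * (if m ∉ T then 1 else 0) + (1 - 2 * δ))
      = (1 - 2 * δ) ^ T.card := by
    rw [← Finset.prod_const, ← Finset.prod_subset (Finset.subset_univ T)]
    · exact Finset.prod_congr rfl fun m hm => by simp [hm]
    · intro m _ hm
      simp [hm]
  rw [← hl, h]
  refine Finset.sum_congr rfl fun R _ => ?_
  rw [Finset.prod_mul_distrib, Finset.prod_boole, refreshWeight]
  have hd : Disjoint R T ↔ ∀ i ∈ R, i ∉ T := Finset.disjoint_left
  by_cases h : ∀ i ∈ R, i ∉ T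
  · rw [if_pos (hd.2 h), if_pos h]
    ring
  · rw [if_neg fun h' => h (hd.1 h'), if_neg h]
    ring

/-- Sharing a label forces no refresh in `(i, j]`. The subtraction is truncated: for `j < i` the
bound is the trivial `1`, so the smaller index should come first. -/
theorem sum_refreshWeight_label_eq_le {δ : ℝ} (h0 : 0 ≤ δ) (h1 : δ ≤ 1 / 2) (i j : Fin n) :
    ∑ R : Finset (Fin n), refreshWeight δ R *
        (if refreshLabel R i.succ = refreshLabel R j.succ then 1 else 0)
      ≤ (1 - 2 * δ) ^ ((j : ℕ) - i) := by
  rw [← Fin.card_Ioc, ← sum_refreshWeight_disjoint]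
  refine Finset.sum_le_sum fun R _ =>
    mul_le_mul_of_nonneg_left ?_ (refreshWeight_nonneg h0 h1 R)
  by_cases h : refreshLabel R i.succ = refreshLabel R j.succ
  · rw [if_pos h, if_pos (disjoint_of_refreshLabel_eq h)]
  · rw [if_neg h]
    split_ifs <;> norm_num

theorem sum_pow_le_of_injOn {α : Type*} (S : Finset α) (f : α → ℕ) (hf : Set.InjOn f S) {q : ℝ}
    (h0 : 0 ≤ q) (h1 : q < 1) : ∑ a ∈ S, q ^ f a ≤ (1 - q)⁻¹ := by
  rw [← tsum_geometric_of_lt_one h0 h1, ← Finset.sum_image (f := fun k => q ^ k) hf]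
  exact (summable_geometric_of_lt_one h0 h1).sum_le_tsum _ fun k _ => pow_nonneg h0 k

/-- The sum of squared block lengths counts ordered pairs in a common block. For fixed `i`, the
probabilities decay geometrically on either side, each side summing to at most `1/(2δ)`. -/
theorem sum_refreshWeight_card_sq_le {δ : ℝ} (h0 : 0 < δ) (h1 : δ ≤ 1 / 2) :
    ∑ R : Finset (Fin n), refreshWeight δ R *
        ∑ k : Fin (n + 1), ((Finset.univ.filter fun i : Fin n => refreshLabel R i.succ = k).card : ℝ) ^ 2
      ≤ n / δ := by
  have hsq : ∀ R : Finset (Fin n),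
      ∑ k : Fin (n + 1), ((Finset.univ.filter fun i : Fin n => refreshLabel R i.succ = k).card : ℝ) ^ 2
      = ∑ i : Fin n, ∑ j : Fin n,
        if refreshLabel R i.succ = refreshLabel R j.succ then (1 : ℝ) else 0 := by
    intro R
    rw [← Finset.sum_fiberwise Finset.univ fun i : Fin n => refreshLabel R i.succ]
    refine Finset.sum_congr rfl fun k _ => ?_
    rw [sq, ← nsmul_eq_mul, ← Finset.sum_const]
    refine Finset.sum_congr rfl fun i hi => ?_
    rw [Finset.sum_boole, (Finset.mem_filter.1 hi).2]
    simp only [eq_comm]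
  have hrow : ∀ i : Fin n, ∑ j : Fin n, ∑ R : Finset (Fin n), refreshWeight δ R *
      (if refreshLabel R i.succ = refreshLabel R j.succ then 1 else 0) ≤ 1 / δ := by
    intro i
    have hq0 : 0 ≤ 1 - 2 * δ := by linarith
    have hq1 : 1 - 2 * δ < 1 := by linarith
    rw [← Finset.sum_filter_add_sum_filter_not Finset.univ fun j => i ≤ j]
    have hA : ∑ j with i ≤ j, ∑ R : Finset (Fin n), refreshWeight δ R *
        (if refreshLabel R i.succ = refreshLabel R j.succ then 1 else 0)
        ≤ (1 - (1 - 2 * δ))⁻¹ := by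
      refine (Finset.sum_le_sum fun j _ => sum_refreshWeight_label_eq_le h0.le h1 i j).trans
        (sum_pow_le_of_injOn _ _ ?_ hq0 hq1)
      intro a ha b hb hab
      simp only [Finset.coe_filter, Finset.mem_univ, true_and, Set.mem_ofPred_eq] at ha hb hab
      ext
      have := Fin.le_def.1 ha
      have := Fin.le_def.1 hb
      omega
    have hB : ∑ j with ¬ i ≤ j, ∑ R : Finset (Fin n), refreshWeight δ R *
        (if refreshLabel R i.succ = refreshLabel R j.succ then 1 else 0)
        ≤ (1 - (1 - 2 * δ))⁻¹ := by
      simp only [eq_comm (a := refreshLabel _ i.succ)]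
      refine (Finset.sum_le_sum fun j _ => sum_refreshWeight_label_eq_le h0.le h1 j i).trans
        (sum_pow_le_of_injOn _ _ ?_ hq0 hq1)
      intro a ha b hb hab
      simp only [Finset.coe_filter, Finset.mem_univ, true_and, Set.mem_ofPred_eq, not_le] at ha hb hab
      ext
      have := Fin.lt_def.1 ha
      have := Fin.lt_def.1 hb
      omega
    refine (add_le_add hA hB).trans (le_of_eq ?_)
    rw [sub_sub_cancel]
    field_simp
    norm_num
  calc _ = ∑ i : Fin n, ∑ j : Fin n, ∑ R : Finset (Fin n), refreshWeight δ R *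
        (if refreshLabel R i.succ = refreshLabel R j.succ then 1 else 0) := by
        simp only [hsq, Finset.mul_sum]
        rw [Finset.sum_comm]
        exact Finset.sum_congr rfl fun i _ => Finset.sum_comm
    _ ≤ ∑ _i : Fin n, 1 / δ := Finset.sum_le_sum fun i _ => hrow i
    _ = n / δ := by simp [div_eq_mul_inv]

end Refresh

/-! ### The sample law as a mixture of labelled models. -/

section SampleLaw

variable {n d : ℕ}

instance measurableSingletonClass_units : MeasurableSingletonClass ℤˣ :=
  ⟨fun u => ⟨{(u : ℤ)}, measurableSet_singleton _, by ext v; simp [Units.ext_iff]⟩⟩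

theorem measurable_observations (θ : EuclideanSpace ℝ (Fin d)) :
    Measurable (observations (n := n) θ) := by
  refine measurable_from_prod_countable_right fun s => ?_
  have h := measurable_add_left_pi (κ := Fin n) (ι := Fin d)
    fun i => (((s i.succ : ℤˣ) : ℤ) : ℝ) • θ
  have he : (fun y => observations θ (s, y))
      = fun (z : Fin n → EuclideanSpace ℝ (Fin d)) i => (((s i.succ : ℤˣ) : ℤ) : ℝ) • θ + z i := by
    funext y i
    rfl
  rwa [he]

theorem sampleLaw_apply (δ : ℝ) (θ : EuclideanSpace ℝ (Fin d))
    {A : Set (Fin n → EuclideanSpace ℝ (Fin d))} (hA : MeasurableSet A) :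
    sampleLaw n d δ θ A = ∑ s : Fin (n + 1) → ℤˣ, ENNReal.ofReal (signPathProb δ s) *
      (Measure.pi fun _ : Fin n => stdGaussian (EuclideanSpace ℝ (Fin d))).map
        (fun z i => (((s i.succ : ℤˣ) : ℤ) : ℝ) • θ + z i) A := by
  have hm := measurable_observations (n := n) θ
  rw [sampleLaw, Measure.map_apply hm hA, Measure.prod_apply (hm hA), signChainLaw,
    lintegral_finsetSum_measure]
  refine Finset.sum_congr rfl fun s _ => ?_
  rw [lintegral_smul_measure, lintegral_dirac' _ (measurable_measure_prodMk_left (hm hA)),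
    Measure.map_apply (measurable_add_left_pi _) hA, smul_eq_mul]
  rfl

theorem signPathProb_nonneg {δ : ℝ} (h0 : 0 ≤ δ) (h1 : δ ≤ 1 / 2) (s : Fin (n + 1) → ℤˣ) :
    0 ≤ signPathProb δ s :=
  mul_nonneg (by norm_num) (Finset.prod_nonneg fun i _ => by split_ifs <;> linarith)

theorem sampleLaw_real_eq_sum {δ : ℝ} (h0 : 0 ≤ δ) (h1 : δ ≤ 1 / 2)
    (θ : EuclideanSpace ℝ (Fin d)) {A : Set (Fin n → EuclideanSpace ℝ (Fin d))}
    (hA : MeasurableSet A) :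
    (sampleLaw n d δ θ).real A = ∑ R : Finset (Fin n), refreshWeight δ R *
      (labelLaw (fun i : Fin n => refreshLabel R i.succ) θ).real A := by
  set g : (Fin (n + 1) → ℤˣ) → ℝ := fun s =>
    ((Measure.pi fun _ : Fin n => stdGaussian (EuclideanSpace ℝ (Fin d))).map
      fun z i => (((s i.succ : ℤˣ) : ℤ) : ℝ) • θ + z i).real A with hg
  have hfin : ∀ s : Fin (n + 1) → ℤˣ,
      (Measure.pi fun _ : Fin n => stdGaussian (EuclideanSpace ℝ (Fin d))).map
        (fun z i => (((s i.succ : ℤˣ) : ℤ) : ℝ) • θ + z i) A ≠ ∞ := fun s =>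
    have := Measure.isProbabilityMeasure_map
      (μ := Measure.pi fun _ : Fin n => stdGaussian (EuclideanSpace ℝ (Fin d)))
      (measurable_add_left_pi fun i => (((s i.succ : ℤˣ) : ℤ) : ℝ) • θ).aemeasurable
    measure_ne_top _ _
  have hL : (sampleLaw n d δ θ).real A = ∑ s, signPathProb δ s * g s := by
    rw [Measure.real, sampleLaw_apply δ θ hA,
      ENNReal.toReal_sum fun s _ => ENNReal.mul_ne_top ENNReal.ofReal_ne_top (hfin s)]
    refine Finset.sum_congr rfl fun s _ => ?_
    rw [ENNReal.toReal_mul, ENNReal.toReal_ofReal (signPathProb_nonneg h0 h1 s)]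
    rfl
  have hR : ∀ R : Finset (Fin n),
      (labelLaw (fun i : Fin n => refreshLabel R i.succ) θ).real A
        = ((2 : ℝ) ^ (n + 1))⁻¹ * ∑ V : Fin (n + 1) → ℤˣ, g (V ∘ refreshLabel R) := by
    intro R
    rw [Measure.real, labelLaw, Measure.finsetSum_apply, ENNReal.toReal_sum, Finset.mul_sum]
    · refine Finset.sum_congr rfl fun V _ => ?_
      rw [Measure.smul_apply, smul_eq_mul, ENNReal.toReal_mul, Fintype.card_fin]
      simp [hg, Measure.real]
    · intro V _
      exact ENNReal.mul_ne_top (by simp) (hfin (V ∘ refreshLabel R))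
  rw [hL]
  simp only [hR, signPathProb_eq_sum_refresh, Finset.sum_mul]
  rw [Finset.sum_comm]
  refine Finset.sum_congr rfl fun R _ => ?_
  simp only [mul_assoc, Finset.sum_mul]
  rw [← Finset.mul_sum, ← Finset.mul_sum, Finset.sum_comm]
  congr 2
  refine Finset.sum_congr rfl fun V _ => ?_
  simp

theorem isProbabilityMeasure_sampleLaw {δ : ℝ} (h0 : 0 ≤ δ) (h1 : δ ≤ 1 / 2)
    (θ : EuclideanSpace ℝ (Fin d)) : IsProbabilityMeasure (sampleLaw n d δ θ) := by
  refine ⟨?_⟩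
  have h := sampleLaw_real_eq_sum (n := n) h0 h1 θ MeasurableSet.univ
  simp only [probReal_univ, mul_one, sum_refreshWeight] at h
  rwa [Measure.real, ENNReal.toReal_eq_one_iff] at h

/-- The bound for labelled models is averaged over `R`. One side of the minimum uses that block
lengths sum to `n`, the other the second-moment bound on them. -/
theorem sampleLaw_testing_error {δ : ℝ} (h0 : 0 < δ) (h1 : δ ≤ 1 / 2)
    {θ θ' : EuclideanSpace ℝ (Fin d)} (hn : ‖θ‖ = ‖θ'‖) (hin : 0 ≤ inner ℝ θ' θ)
    {A : Set (Fin n → EuclideanSpace ℝ (Fin d))} (hA : MeasurableSet A) :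
    1 / 2 - (‖θ‖ ^ 2 - inner ℝ θ' θ) * min (n : ℝ) (‖θ‖ ^ 2 * (n / δ))
      ≤ (sampleLaw n d δ θ).real A + (sampleLaw n d δ θ').real Aᶜ := by
  have hD : 0 ≤ ‖θ‖ ^ 2 - inner ℝ θ' θ := by
    have := real_inner_le_norm θ' θ
    rw [← hn, ← sq] at this
    linarith
  set D := ‖θ‖ ^ 2 - inner ℝ θ' θ with hDdef
  have hw := fun R : Finset (Fin n) => refreshWeight_nonneg h0.le h1 R
  rw [sampleLaw_real_eq_sum h0.le h1 θ hA, sampleLaw_real_eq_sum h0.le h1 θ' hA.compl,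
    ← Finset.sum_add_distrib]
  simp only [← mul_add]
  refine le_trans ?_ (Finset.sum_le_sum fun R _ => mul_le_mul_of_nonneg_left
    (labelLaw_testing_error (fun i : Fin n => refreshLabel R i.succ) hn hin hA) (hw R))
  simp only [mul_sub, Finset.sum_sub_distrib, ← Finset.sum_mul, sum_refreshWeight, one_mul]
  refine sub_le_sub_left ?_ _
  simp only [← mul_sub, ← hDdef]
  rw [mul_min_of_nonneg _ _ hD]
  refine le_min ?_ ?_
  · calc _ ≤ ∑ R : Finset (Fin n), refreshWeight δ R * (D * n) := by
          refine Finset.sum_le_sum fun R _ => mul_le_mul_of_nonneg_left ?_ (hw R)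
          calc _ ≤ ∑ k : Fin (n + 1),
                ((Finset.univ.filter fun i : Fin n => refreshLabel R i.succ = k).card : ℝ) * D :=
                Finset.sum_le_sum fun k _ => mul_le_of_le_one_right
                  (mul_nonneg (Nat.cast_nonneg _) hD) (min_le_left _ _)
            _ = D * n := by
                rw [← Finset.sum_mul, ← Nat.cast_sum, mul_comm,
                  ← Finset.card_eq_sum_card_fiberwise fun i _ => Finset.mem_coe.2 (Finset.mem_univ _)]
                simp
      _ = D * n := by rw [← Finset.sum_mul, sum_refreshWeight, one_mul]
  · calc _ ≤ ∑ R : Finset (Fin n), refreshWeight δ R * ((D * ‖θ‖ ^ 2) * ∑ k : Fin (n + 1),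
            ((Finset.univ.filter fun i : Fin n => refreshLabel R i.succ = k).card : ℝ) ^ 2) := by
          refine Finset.sum_le_sum fun R _ => mul_le_mul_of_nonneg_left ?_ (hw R)
          rw [Finset.mul_sum]
          refine Finset.sum_le_sum fun k _ => ?_
          refine (mul_le_mul_of_nonneg_left (min_le_right _ _)
            (mul_nonneg (Nat.cast_nonneg _) hD)).trans (le_of_eq ?_)
          ring
      _ = (D * ‖θ‖ ^ 2) * ∑ R : Finset (Fin n), refreshWeight δ R * ∑ k : Fin (n + 1),
            ((Finset.univ.filter fun i : Fin n => refreshLabel R i.succ = k).card : ℝ) ^ 2 := by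
          rw [Finset.mul_sum]
          exact Finset.sum_congr rfl fun R _ => by ring
      _ ≤ (D * ‖θ‖ ^ 2) * (n / δ) :=
          mul_le_mul_of_nonneg_left (sum_refreshWeight_card_sq_le h0 h1)
            (mul_nonneg hD (sq_nonneg _))
      _ = D * (‖θ‖ ^ 2 * (n / δ)) := by ring

end SampleLaw

/-! ### The cube of parameters and the sign-invariant loss. -/

section Cube

variable {m : ℕ}

/-- The vertices of a cube of side `2b` in the hyperplane where the first coordinate is `a`. -/
noncomputable def cubePoint (a b : ℝ) (v : Fin m → ℤˣ) : EuclideanSpace ℝ (Fin (m + 1)) :=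
  WithLp.toLp 2 (Fin.cons a fun j => (((v j : ℤˣ) : ℤ) : ℝ) * b)

@[simp]
theorem cubePoint_zero (a b : ℝ) (v : Fin m → ℤˣ) : cubePoint a b v 0 = a := rfl

@[simp]
theorem cubePoint_succ (a b : ℝ) (v : Fin m → ℤˣ) (j : Fin m) :
    cubePoint a b v j.succ = (((v j : ℤˣ) : ℤ) : ℝ) * b := rfl

theorem Int.cast_units_sq (v : ℤˣ) : (((v : ℤ) : ℝ)) ^ 2 = 1 := by
  rcases Int.units_eq_one_or v with rfl | rfl <;> simp

theorem norm_sq_cubePoint (a b : ℝ) (v : Fin m → ℤˣ) :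
    ‖cubePoint a b v‖ ^ 2 = a ^ 2 + m * b ^ 2 := by
  rw [EuclideanSpace.real_norm_sq_eq, Fin.sum_univ_succ]
  simp [mul_pow, Int.cast_units_sq]

/-- Change the `j`-th sign. -/
def flipSign (j : Fin m) (v : Fin m → ℤˣ) : Fin m → ℤˣ := Function.update v j (-v j)

theorem flipSign_involutive (j : Fin m) : Function.Involutive (flipSign j) := by
  intro v
  simp [flipSign]

theorem inner_cubePoint_flipSign (a b : ℝ) (v : Fin m → ℤˣ) (j : Fin m) :
    inner ℝ (cubePoint a b (flipSign j v)) (cubePoint a b v) = a ^ 2 + m * b ^ 2 - 2 * b ^ 2 := by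
  have h : ∀ i, (((v i : ℤˣ) : ℤ) : ℝ) * b * ((((flipSign j v) i : ℤˣ) : ℤ) * b)
      = b ^ 2 - if i = j then 2 * b ^ 2 else 0 := by
    intro i
    have hi := Int.cast_units_sq (v i)
    by_cases hij : i = j
    · subst hij
      simp only [flipSign, Function.update_self, Units.val_neg, Int.cast_neg, if_true]
      linear_combination (-b ^ 2) * hi
    · simp only [flipSign, Function.update_of_ne hij, if_neg hij]
      linear_combination (b ^ 2) * hi
  rw [PiLp.inner_apply, Fin.sum_univ_succ]
  simp only [cubePoint_zero, cubePoint_succ, RCLike.inner_apply, conj_trivial]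
  rw [Finset.sum_congr rfl fun i _ => h i, Finset.sum_sub_distrib]
  simp
  ring

/-- The sign of the coordinate `j + 1` of `w` after `w` is replaced by `-w` if necessary to make
its first coordinate nonnegative. -/
noncomputable def signGuess (w : EuclideanSpace ℝ (Fin (m + 1))) (j : Fin m) : ℤˣ :=
  if 0 ≤ (if 0 ≤ w 0 then 1 else -1) * w j.succ then 1 else -1

theorem measurableSet_signGuess_ne (j : Fin m) (u : ℤˣ) :
    MeasurableSet {w : EuclideanSpace ℝ (Fin (m + 1)) | signGuess w j ≠ u} := by
  have hc : ∀ i, Measurable fun w : EuclideanSpace ℝ (Fin (m + 1)) => w i := fun i => by fun_prop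
  have hm : Measurable fun w : EuclideanSpace ℝ (Fin (m + 1)) => signGuess w j := by
    refine Measurable.ite (measurableSet_le measurable_const (Measurable.mul ?_ (hc _)))
      measurable_const measurable_const
    exact Measurable.ite (measurableSet_le measurable_const (hc 0)) measurable_const
      measurable_const
  exact hm (measurableSet_singleton u).compl

/-- Every wrong sign costs `b²` in its own coordinate. For the opposite global sign the first
coordinate alone costs `a² ≥ m b²`, which already covers `m` errors; the large coordinate `a` thus
resolves the sign ambiguity. -/
theorem card_mul_sq_le_norm_sq {a b : ℝ} (ha : 0 ≤ a) (hb : 0 ≤ b) (hab : m * b ^ 2 ≤ a ^ 2)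
    (v g : Fin m → ℤˣ) (w : EuclideanSpace ℝ (Fin (m + 1))) (hw : 0 ≤ w 0)
    (hg : ∀ j, g j = if 0 ≤ w j.succ then 1 else -1) :
    (Finset.univ.filter fun j => g j ≠ v j).card * b ^ 2 ≤ ‖cubePoint a b v - w‖ ^ 2 ∧
      (Finset.univ.filter fun j => g j ≠ v j).card * b ^ 2 ≤ ‖cubePoint a b v + w‖ ^ 2 := by
  rw [EuclideanSpace.real_norm_sq_eq, EuclideanSpace.real_norm_sq_eq, Fin.sum_univ_succ,
    Fin.sum_univ_succ]
  simp only [PiLp.sub_apply, PiLp.add_apply, cubePoint_zero, cubePoint_succ]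
  constructor
  · refine le_add_of_nonneg_of_le (sq_nonneg _) ?_
    rw [← nsmul_eq_mul, ← Finset.sum_const]
    refine (Finset.sum_le_sum fun j hj => ?_).trans
      (Finset.sum_le_sum_of_subset_of_nonneg (Finset.filter_subset _ _) fun j _ _ => sq_nonneg _)
    have hj := (Finset.mem_filter.1 hj).2
    rw [hg] at hj
    rcases Int.units_eq_one_or (v j) with h | h
    · rw [h] at hj ⊢
      have : w j.succ < 0 := by
        by_contra hc
        exact hj (if_pos (not_lt.1 hc))
      simp only [Units.val_one, Int.cast_one, one_mul]
      nlinarith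
    · rw [h] at hj ⊢
      have : 0 ≤ w j.succ := by
        by_contra hc
        exact hj (if_neg hc)
      simp only [Units.val_neg, Units.val_one, Int.cast_neg, Int.cast_one]
      nlinarith
  · have h1 : ((Finset.univ.filter fun j => g j ≠ v j).card : ℝ) ≤ m := by
      have := Finset.card_filter_le (Finset.univ : Finset (Fin m)) fun j => g j ≠ v j
      rw [Finset.card_univ, Fintype.card_fin] at this
      exact_mod_cast this
    have h2 : a ^ 2 ≤ (a + w 0) ^ 2 := by nlinarith
    have h3 : 0 ≤ ∑ j : Fin m, ((((v j : ℤˣ) : ℤ) : ℝ) * b + w j.succ) ^ 2 :=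
      Finset.sum_nonneg fun j _ => sq_nonneg _
    nlinarith [mul_le_mul_of_nonneg_right h1 (sq_nonneg b)]

theorem card_mul_sq_le_signLoss_sq {a b : ℝ} (ha : 0 ≤ a) (hb : 0 ≤ b)
    (hab : m * b ^ 2 ≤ a ^ 2) (v : Fin m → ℤˣ) (w : EuclideanSpace ℝ (Fin (m + 1))) :
    (Finset.univ.filter fun j => signGuess w j ≠ v j).card * b ^ 2
      ≤ signLoss (cubePoint a b v) w ^ 2 := by
  have h : (Finset.univ.filter fun j => signGuess w j ≠ v j).card * b ^ 2
        ≤ ‖cubePoint a b v - w‖ ^ 2 ∧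
      (Finset.univ.filter fun j => signGuess w j ≠ v j).card * b ^ 2
        ≤ ‖cubePoint a b v + w‖ ^ 2 := by
    by_cases h0 : 0 ≤ w 0
    · exact card_mul_sq_le_norm_sq ha hb hab v _ w h0 fun j => by simp [signGuess, h0]
    · have := card_mul_sq_le_norm_sq ha hb hab v (signGuess w) (-w)
        (by simp only [PiLp.neg_apply]; linarith) fun j => by simp [signGuess, h0]
      rwa [sub_neg_eq_add, ← sub_eq_add_neg, and_comm] at this
  rw [signLoss]
  rcases min_choice ‖cubePoint a b v - w‖ ‖cubePoint a b v + w‖ with hmin | hmin <;> rw [hmin]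
  exacts [h.1, h.2]

theorem signLoss_nonneg {d : ℕ} (θ' θ : EuclideanSpace ℝ (Fin d)) : 0 ≤ signLoss θ' θ :=
  le_min (norm_nonneg _) (norm_nonneg _)

/-- With `H ≤ m` errors, `H b² ≥ (H b)² / m`. This makes the lower bound linear in the error count,
as needed for taking expectations. -/
theorem card_mul_le_signLoss {a b : ℝ} (ha : 0 ≤ a) (hb : 0 ≤ b)
    (hab : m * b ^ 2 ≤ a ^ 2) (v : Fin m → ℤˣ) (w : EuclideanSpace ℝ (Fin (m + 1))) :
    b / √m * (Finset.univ.filter fun j => signGuess w j ≠ v j).card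
      ≤ signLoss (cubePoint a b v) w := by
  refine (pow_le_pow_iff_left₀ (by positivity) (signLoss_nonneg _ _) two_ne_zero).1
    (le_trans ?_ (card_mul_sq_le_signLoss_sq ha hb hab v w))
  set H : ℝ := ((Finset.univ.filter fun j => signGuess w j ≠ v j).card : ℝ) with hH
  have hH0 : 0 ≤ H := Nat.cast_nonneg _
  have hHm : H ≤ m := by
    have := Finset.card_filter_le (Finset.univ : Finset (Fin m)) fun j => signGuess w j ≠ v j
    rw [Finset.card_univ, Fintype.card_fin] at this
    rw [hH]
    exact_mod_cast this
  rw [mul_pow, div_pow, Real.sq_sqrt (Nat.cast_nonneg m)]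
  rcases (Nat.cast_nonneg m : (0 : ℝ) ≤ m).eq_or_lt with hm | hm
  · have : H = 0 := le_antisymm (hHm.trans hm.symm.le) hH0
    simp [this]
  · rw [div_mul_eq_mul_div, div_le_iff₀ hm]
    have := mul_le_mul_of_nonneg_left hHm (mul_nonneg (sq_nonneg b) hH0)
    linarith

end Cube

/-! ### Assouad's argument. -/

section Assouad

variable {n m : ℕ}

/-- For each coordinate, vertices are paired by `flipSign`. Each pair has total error at least `1/2
- 1/4`, so the average error per coordinate over the cube is at least `1/8`, and some vertex attains
the average of the sums. -/
theorem exists_sum_error_ge {δ a b : ℝ} (h0 : 0 < δ) (h1 : δ ≤ 1 / 2)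
    (hab : 2 * b ^ 2 ≤ a ^ 2 + m * b ^ 2)
    (hsmall : 2 * b ^ 2 * min (n : ℝ) ((a ^ 2 + m * b ^ 2) * (n / δ)) ≤ 1 / 4)
    {guess : (Fin n → EuclideanSpace ℝ (Fin (m + 1))) → Fin m → ℤˣ}
    (hmeas : ∀ j u, MeasurableSet {x | guess x j ≠ u}) :
    ∃ v : Fin m → ℤˣ, (m : ℝ) / 8
      ≤ ∑ j, (sampleLaw n (m + 1) δ (cubePoint a b v)).real {x | guess x j ≠ v j} := by
  set P : (Fin m → ℤˣ) → Fin m → ℝ := fun v j =>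
    (sampleLaw n (m + 1) δ (cubePoint a b v)).real {x | guess x j ≠ v j} with hP
  have hpair : ∀ v j, 1 / 4 ≤ P v j + P (flipSign j v) j := by
    intro v j
    have hn : ‖cubePoint a b v‖ = ‖cubePoint a b (flipSign j v)‖ := by
      rw [← sq_eq_sq₀ (norm_nonneg _) (norm_nonneg _), norm_sq_cubePoint, norm_sq_cubePoint]
    have hin := inner_cubePoint_flipSign a b v j
    have := sampleLaw_testing_error (n := n) h0 h1 hn (by rw [hin]; linarith) (hmeas j (v j))
    rw [hin, norm_sq_cubePoint, sub_sub_cancel] at this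
    have hcompl : {x | guess x j ≠ v j}ᶜ = {x | guess x j ≠ flipSign j v j} := by
      ext x
      simp only [Set.mem_compl_iff, Set.mem_ofPred_eq, not_not, flipSign, Function.update_self]
      rcases Int.units_eq_one_or (guess x j) with h | h <;>
        rcases Int.units_eq_one_or (v j) with h' | h' <;> rw [h, h'] <;> decide
    rw [hcompl] at this
    simp only [hP]
    linarith
  have hsum : ∀ j, ∑ _v : Fin m → ℤˣ, (1 / 8 : ℝ) ≤ ∑ v, P v j := by
    intro j
    have hflip : ∑ v, P (flipSign j v) j = ∑ v, P v j :=
      Equiv.sum_comp (flipSign_involutive j).toPerm fun v => P v j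
    have h4 : ∑ _v : Fin m → ℤˣ, (1 / 4 : ℝ) ≤ ∑ v, (P v j + P (flipSign j v) j) :=
      Finset.sum_le_sum fun v _ => hpair v j
    rw [Finset.sum_add_distrib, hflip] at h4
    have h8 : ∑ _v : Fin m → ℤˣ, (1 / 4 : ℝ) = 2 * ∑ _v : Fin m → ℤˣ, (1 / 8 : ℝ) := by
      rw [Finset.mul_sum]
      norm_num
    linarith
  obtain ⟨v, -, hv⟩ := Finset.exists_le_of_sum_le (s := Finset.univ)
    (f := fun _ : Fin m → ℤˣ => (m : ℝ) / 8) (g := fun v => ∑ j, P v j)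
    Finset.univ_nonempty (by
      rw [Finset.sum_comm]
      refine le_trans (le_of_eq ?_) (Finset.sum_le_sum fun j _ => hsum j)
      simp
      ring)
  exact ⟨v, hv⟩

theorem ofReal_le_localMinimaxRate {δ t a b : ℝ} (h0 : 0 < δ) (h1 : δ ≤ 1 / 2) (ht : 0 ≤ t)
    (ha : 0 ≤ a) (hb : 0 ≤ b) (hat : a ^ 2 + m * b ^ 2 = t ^ 2) (hab : m * b ^ 2 ≤ a ^ 2)
    (hbt : 2 * b ^ 2 ≤ t ^ 2) (hsmall : 2 * b ^ 2 * min (n : ℝ) (t ^ 2 * (n / δ)) ≤ 1 / 4) :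
    ENNReal.ofReal (b * √m / 8) ≤ localMinimaxRate n (m + 1) δ t := by
  refine le_iInf₂ fun est hest => ?_
  have hmeas : ∀ j u, MeasurableSet {x | signGuess (est x) j ≠ u} := fun j u =>
    hest (measurableSet_signGuess_ne j u)
  rw [← hat] at hsmall
  obtain ⟨v, hv⟩ := exists_sum_error_ge (n := n) h0 h1 (hat ▸ hbt) hsmall hmeas
  have hnorm : ‖cubePoint a b v‖ = t := by
    rw [← sq_eq_sq₀ (norm_nonneg _) ht, norm_sq_cubePoint, hat]
  refine le_trans ?_ (le_iSup₂_of_le (cubePoint a b v) hnorm le_rfl)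
  have hprob := isProbabilityMeasure_sampleLaw (n := n) h0.le h1 (cubePoint a b v)
  set μ := sampleLaw n (m + 1) δ (cubePoint a b v) with hμ
  have hint : Integrable (fun x => b / √m * ∑ j,
      {x | signGuess (est x) j ≠ v j}.indicator (fun _ => (1 : ℝ)) x) μ :=
    (integrable_finsetSum _ fun j _ =>
      (integrable_const (1 : ℝ)).indicator (hmeas j (v j))).const_mul _
  have hnonneg : ∀ x, 0 ≤ b / √m * ∑ j,
      {x | signGuess (est x) j ≠ v j}.indicator (fun _ => (1 : ℝ)) x := fun x =>
    mul_nonneg (by positivity)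
      (Finset.sum_nonneg fun j _ => Set.indicator_nonneg (fun _ _ => zero_le_one) _)
  calc ENNReal.ofReal (b * √m / 8)
      ≤ ENNReal.ofReal (b / √m * ∑ j, μ.real {x | signGuess (est x) j ≠ v j}) := by
        refine ENNReal.ofReal_le_ofReal ?_
        refine le_trans (le_of_eq ?_) (mul_le_mul_of_nonneg_left hv (by positivity))
        rcases (Nat.cast_nonneg m : (0 : ℝ) ≤ m).eq_or_lt with hm | hm
        · simp [← hm]
        · have hs := Real.sq_sqrt hm.le
          have := Real.sqrt_pos.2 hm
          field_simp
          linear_combination b * hs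
    _ = ENNReal.ofReal (∫ x, b / √m * ∑ j,
          {x | signGuess (est x) j ≠ v j}.indicator (fun _ => (1 : ℝ)) x ∂μ) := by
        rw [integral_const_mul, integral_finsetSum _ fun j _ =>
          (integrable_const (1 : ℝ)).indicator (hmeas j (v j))]
        simp only [integral_indicator_const _ (hmeas _ _), smul_eq_mul, mul_one]
    _ = ∫⁻ x, ENNReal.ofReal (b / √m * ∑ j,
          {x | signGuess (est x) j ≠ v j}.indicator (fun _ => (1 : ℝ)) x) ∂μ :=
        ofReal_integral_eq_lintegral_ofReal hint (.of_forall hnonneg)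
    _ ≤ ∫⁻ x, ENNReal.ofReal (signLoss (cubePoint a b v) (est x)) ∂μ := by
        refine lintegral_mono fun x => ENNReal.ofReal_le_ofReal ?_
        refine le_trans (le_of_eq ?_) (card_mul_le_signLoss ha hb hab v (est x))
        congr 1
        rw [← Finset.sum_boole]
        exact Finset.sum_congr rfl fun j _ => by simp [Set.indicator_apply]

end Assouad

/-! ### Choice of the cube and the three regimes. -/

section Rate

/-- These are the only properties of the rate that the cube needs: it fits in the sphere of radius
`t`, and one side of the minimum in the testing bound is controlled. -/
theorem threePieceRate_bounds {n d : ℕ} {δ t : ℝ} (hn : 0 < n) (hd : 0 < d)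
    (hdn : (d : ℝ) ≤ δ * n) (ht : 0 ≤ t) :
    0 ≤ threePieceRate n d δ t ∧ threePieceRate n d δ t ≤ t ∧
      (threePieceRate n d δ t ^ 2 * n ≤ d ∨ threePieceRate n d δ t ^ 2 * t ^ 2 * n ≤ δ * d) := by
  have hn' : (0 : ℝ) < n := Nat.cast_pos.2 hn
  have hd' : (0 : ℝ) < d := Nat.cast_pos.2 hd
  have hδ : 0 < δ := pos_of_mul_pos_left (hd'.trans_le hdn) hn'.le
  have hq : 0 < δ * d / n := by positivity
  have hfour : ((δ * d / n) ^ (1 / 4 : ℝ)) ^ 4 = δ * d / n := by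
    rw [← Real.rpow_natCast, ← Real.rpow_mul hq.le]
    norm_num
  unfold threePieceRate
  split_ifs with h1 h2
  · refine ⟨ht, le_rfl, Or.inr ?_⟩
    have := pow_le_pow_left₀ ht h1 4
    rw [hfour, le_div_iff₀ hn'] at this
    linarith
  · have hpos : 0 < (δ * d / n) ^ (1 / 4 : ℝ) := Real.rpow_pos_of_pos hq _
    have ht0 : 0 < t := hpos.trans (not_le.1 h1)
    have h4 := pow_le_pow_left₀ hpos.le (not_le.1 h1).le 4
    rw [hfour] at h4
    refine ⟨by positivity, ?_, Or.inr (le_of_eq ?_)⟩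
    · rw [one_div, inv_mul_le_iff₀ ht0]
      refine Real.sqrt_le_iff.2 ⟨by positivity, h4.trans (le_of_eq (by ring))⟩
    · rw [mul_pow, Real.sq_sqrt hq.le]
      field_simp
  · have ht2 : δ ≤ t ^ 2 := (Real.sqrt_le_left ht).1 (not_le.1 h2).le
    refine ⟨Real.sqrt_nonneg _, Real.sqrt_le_iff.2 ⟨ht, ?_⟩, Or.inl (le_of_eq ?_)⟩
    · exact ((div_le_iff₀ hn').2 hdn).trans ht2
    · rw [Real.sq_sqrt (by positivity)]
      field_simp

theorem ofReal_threePieceRate_le_localMinimaxRate {n d : ℕ} {δ t : ℝ} (hd : 2 ≤ d)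
    (hdn : (d : ℝ) ≤ δ * n) (hδ : δ ≤ 1 / 2) (ht : 0 ≤ t) :
    ENNReal.ofReal (1 / 64 * threePieceRate n d δ t) ≤ localMinimaxRate n d δ t := by
  obtain ⟨m, rfl⟩ : ∃ m, d = m + 1 := ⟨d - 1, by omega⟩
  have hm1 : (1 : ℝ) ≤ m := by exact_mod_cast (by omega : 1 ≤ m)
  have hdm : ((m + 1 : ℕ) : ℝ) = m + 1 := by push_cast; rfl
  have hn : 0 < n := by
    rcases Nat.eq_zero_or_pos n with rfl | h
    · rw [hdm, Nat.cast_zero, mul_zero] at hdn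
      linarith
    · exact h
  have hn' : (0 : ℝ) < n := Nat.cast_pos.2 hn
  have hδ0 : 0 < δ := pos_of_mul_pos_left (lt_of_lt_of_le (by rw [hdm]; linarith) hdn) hn'.le
  obtain ⟨hr0, hrt, hr⟩ := threePieceRate_bounds hn (by omega) hdn ht
  set r := threePieceRate n (m + 1) δ t with hrdef
  rw [hdm] at hr
  -- Chosen so that `16 d b² = r²`: either alternative for `r` then gives `2b² min(n, t² n/δ) ≤
  -- 1/8`, and `m b² ≤ t²/16` leaves room for the first coordinate.
  set b := r / (4 * √(m + 1)) with hbdef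
  have hm2 : (0 : ℝ) < m + 1 := by linarith
  have hb0 : 0 ≤ b := by positivity
  have hb : b ^ 2 * (16 * (m + 1)) = r ^ 2 := by
    rw [hbdef, div_pow, mul_pow, Real.sq_sqrt hm2.le]
    field_simp
    norm_num
  have hrt2 : r ^ 2 ≤ t ^ 2 := pow_le_pow_left₀ hr0 hrt 2
  have hb2 := sq_nonneg b
  have hmb : m * b ^ 2 ≤ t ^ 2 / 16 := by nlinarith
  have hb1 : b ^ 2 ≤ m * b ^ 2 := le_mul_of_one_le_left hb2 hm1
  have ha : √(t ^ 2 - m * b ^ 2) ^ 2 = t ^ 2 - m * b ^ 2 :=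
    Real.sq_sqrt (by nlinarith [sq_nonneg t])
  refine le_trans (ENNReal.ofReal_le_ofReal ?_)
    (ofReal_le_localMinimaxRate (n := n) (a := √(t ^ 2 - m * b ^ 2)) hδ0 hδ ht (Real.sqrt_nonneg _)
      hb0 (by rw [ha]; ring) (by rw [ha]; nlinarith [sq_nonneg t]) (by nlinarith [sq_nonneg t]) ?_)
  -- The constant: `r / 64 = b √(m + 1) / 16 ≤ b √m / 8`, using `m ≥ 1`.
  · have hs : √(m + 1 : ℝ) ≤ 2 * √m := by
      refine Real.sqrt_le_iff.2 ⟨by positivity, ?_⟩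
      rw [mul_pow, Real.sq_sqrt (by linarith)]
      linarith
    have hsp : 0 < √(m + 1 : ℝ) := Real.sqrt_pos.2 hm2
    have hrb : r = b * (4 * √(m + 1)) := by
      rw [hbdef]
      field_simp
    rw [hrb]
    nlinarith [mul_le_mul_of_nonneg_left hs hb0]
  · rcases hr with hr | hr
    · refine (mul_le_mul_of_nonneg_left (min_le_left _ _) (by positivity)).trans ?_
      rw [← hb] at hr
      have : b ^ 2 * 16 * n ≤ 1 := by
        refine le_of_mul_le_mul_right ?_ hm2
        linarith
      linarith
    · refine (mul_le_mul_of_nonneg_left (min_le_right _ _) (by positivity)).trans ?_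
      rw [← hb] at hr
      have : b ^ 2 * 16 * t ^ 2 * n ≤ δ := by
        refine le_of_mul_le_mul_right ?_ hm2
        linarith
      have h2 : b ^ 2 * 16 * (t ^ 2 * (n / δ)) ≤ 1 := by
        rw [← mul_div_assoc, ← mul_div_assoc, div_le_one hδ0]
        linarith
      linarith

end Rate

theorem theorem2 :
    ∃ c : ℝ, 0 < c ∧ ∀ (n d : ℕ) (δ t : ℝ),
      2 ≤ d → (d : ℝ) ≤ δ * n → δ ≤ 1 / 2 → (128 : ℝ) / d ≤ n → 0 ≤ t →
        ENNReal.ofReal (c * (1 / √(Real.log n)) * threePieceRate n d δ t)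
          ≤ localMinimaxRate n d δ t := by
  refine ⟨1 / 64, by norm_num, fun n d δ t hd hdn hδ _ ht => ?_⟩
  refine le_trans (ENNReal.ofReal_le_ofReal ?_)
    (ofReal_threePieceRate_le_localMinimaxRate hd hdn hδ ht)
  have hd2 : (2 : ℝ) ≤ d := by exact_mod_cast hd
  -- From `2 ≤ d ≤ δ n ≤ n / 2`; this puts `n` above `e`, so the factor `1 / √(log n)` is at most
  -- `1`.
  have hn4 : (4 : ℝ) ≤ n := by
    have hn0 : (0 : ℝ) ≤ n := Nat.cast_nonneg n
    nlinarith
  have hn : 0 < n := by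
    have : (0 : ℝ) < n := by linarith
    exact_mod_cast this
  have hr0 := (threePieceRate_bounds hn (by omega) hdn ht).1
  have hlog : 1 ≤ Real.log n := by
    rw [Real.le_log_iff_exp_le (by linarith)]
    linarith [Real.exp_one_lt_d9]
  have hsqrt : 1 / √(Real.log n) ≤ 1 :=
    (div_le_one (by positivity)).2 (Real.one_le_sqrt.2 hlog)
  refine mul_le_mul_of_nonneg_right ?_ hr0
  linarith
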